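/- Let $F$ be a $p$-adic field (a finite extension of $\mathbb{Q}_p$) with residue field of $q$ elements and Weil group $W_F$, and for $w\in W_F$ let $|w|_F=q^n$ if $w$ acts on the residue field of $\overline F$ as $x\mapsto x^{q^n}$. Put $d_w=\mathrm{diag}(|w|_F^{1/2},|w|_F^{-1/2})\in \mathrm{SL}_2(\mathbb{C})$. Let $G$ be a connected reductive algebraic group over $F$, with complex dual group $\widehat G$, $\widehat{\mathfrak g}=\mathrm{Lie}(\widehat G)$, and L-group ${}^LG=\widehat G\rtimes W_F$. A *Langlands parameter* of $G$ is a continuous homomorphism $\phi: W_F\times \mathrm{SL}_2(\mathbb{C})\to {}^LG$ that commutes with the projections to $W_F$, is algebraic on $\mathrm{SL}_2(\mathbb{C})$, and sends Frobenius elements to semisimple elements (no relevance condition is imposed). An *Arthur parameter* is a continuous homomorphism $\psi: W_F\times \mathrm{SL}_2(\mathbb{C})\times \mathrm{SL}_2(\mathbb{C})\to {}^LG$ that commutes with the projections to $W_F$, is algebraic on both copies of $\mathrm{SL}_2(\mathbb{C})$, sends Frobenius elements to semisimple elements, and whose restriction to $W_F$ is bounded, i.e. has relatively compact image in $\widehat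 G$. Let $\phi$ be a Langlands parameter. * $\phi$ is *tempered* if its restriction to $W_F$ is bounded, i.e. has relatively compact image in $\widehat G$. * $\phi$ is *of Arthur type* if there is an Arthur parameter $\psi$ with $\phi(w,x)=\psi(w,x,d_w)$ for all $w\in W_F$ and $x\in \mathrm{SL}_2(\mathbb{C})$. * Let $\lambda(w)=\phi(w,d_w)$, let $V_\lambda=\{x\in\widehat{\mathfrak g} : \mathrm{Ad}(\lambda(w))x=|w|_F\,x \text{ for all } w\in W_F\}$, let $H_\lambda$ be the centralizer of $\lambda$ in $\widehat G$, acting on $V_\lambda$ by conjugation, and let $x_\phi=d\phi\left(\begin{smallmatrix}0&1\\0&0\end{smallmatrix}\right)\in V_\lambda$. Then $\phi$ is *open* if the $H_\lambda$-orbit of $x_\phi$ is open in $V_\lambda$ for the Zariski topology. **Proposition.** A Langlands parameter of $G$ is tempered if and only if it is open and of Arthur type. -/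

import Mathlib

open scoped Matrix MatrixGroups
open Matrix

noncomputable section

/-! ### The `p`-adic field `F`, its residue field, and its Weil group

`F` is a finite extension of `ℚ_[p]`.  Every algebraic extension `L` of `ℚ_[p]` carries the unique
extension of the `p`-adic absolute value, Mathlib's `spectralNorm ℚ_[p] L`. -/

/-- The ring of integers of an algebraic extension `L` of `ℚ_[p]`: the elements of absolute value
at most `1`. -/
def padicIntegers (p : ℕ) [Fact p.Prime] (L : Type*) [Field L] [Algebra ℚ_[p] L]
    [Algebra.IsAlgebraic ℚ_[p] L] : ValuationSubring L :=
  letI := spectralNorm.normedField ℚ_[p] L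
  haveI : IsUltrametricDist L :=
    IsUltrametricDist.isUltrametricDist_of_forall_norm_add_le_max_norm
      (isNonarchimedean_spectralNorm (K := ℚ_[p]) (L := L))
  (NormedField.valuation (K := L)).valuationSubring

theorem mem_padicIntegers (p : ℕ) [Fact p.Prime] (L : Type*) [Field L] [Algebra ℚ_[p] L]
    [Algebra.IsAlgebraic ℚ_[p] L] (x : L) :
    x ∈ padicIntegers p L ↔ spectralNorm ℚ_[p] L x ≤ 1 := Iff.rfl

/-- The number `q` of elements of the residue field of `F`. -/
def residueCard (p : ℕ) [Fact p.Prime] (F : Type*) [Field F] [Algebra ℚ_[p] F]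
    [Algebra.IsAlgebraic ℚ_[p] F] : ℕ :=
  Nat.card (IsLocalRing.ResidueField (padicIntegers p F))

theorem mem_maximalIdeal_padicIntegers (p : ℕ) [Fact p.Prime] (L : Type*) [Field L]
    [Algebra ℚ_[p] L] [Algebra.IsAlgebraic ℚ_[p] L] (x : padicIntegers p L) :
    x ∈ IsLocalRing.maximalIdeal (padicIntegers p L) ↔ spectralNorm ℚ_[p] L x < 1 := by
  rw [IsLocalRing.mem_maximalIdeal, mem_nonunits_iff]
  let nf := spectralNorm.normedField ℚ_[p] L
  change _ ↔ ‖(x : L)‖ < 1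
  have hx : ‖(x : L)‖ ≤ 1 := x.2
  constructor
  · intro h
    refine lt_of_le_of_ne hx fun h1 => h ?_
    have h0 : (x : L) ≠ 0 := by
      intro h0
      rw [h0, norm_zero] at h1
      exact zero_ne_one h1
    have hinv : ((x : L))⁻¹ ∈ padicIntegers p L := by
      change ‖((x : L))⁻¹‖ ≤ 1
      rw [norm_inv, h1, inv_one]
    exact IsUnit.of_mul_eq_one ⟨_, hinv⟩ (Subtype.ext (mul_inv_cancel₀ h0))
  · rintro h ⟨u, rfl⟩
    have h1 : ((u : padicIntegers p L) : L) *
        (((u⁻¹ : (padicIntegers p L)ˣ) : padicIntegers p L) : L) = 1 :=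
      congrArg (Subtype.val) u.mul_inv
    have h2 : ‖(((u⁻¹ : (padicIntegers p L)ˣ) : padicIntegers p L) : L)‖ ≤ 1 :=
      ((u⁻¹ : (padicIntegers p L)ˣ) : padicIntegers p L).2
    have h3 := congrArg norm h1
    rw [norm_mul, norm_one] at h3
    nlinarith [norm_nonneg ((u : padicIntegers p L) : L)]

theorem residueCard_ne_zero (p : ℕ) [Fact p.Prime] (F : Type*) [Field F] [Algebra ℚ_[p] F]
    [FiniteDimensional ℚ_[p] F] : residueCard p F ≠ 0 := by
  let nf := spectralNorm.nontriviallyNormedField ℚ_[p] F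
  have hu : IsUltrametricDist F :=
    IsUltrametricDist.isUltrametricDist_of_forall_norm_add_le_max_norm
      (isNonarchimedean_spectralNorm (K := ℚ_[p]) (L := F))
  let na : NormedAlgebra ℚ_[p] F := spectralNorm.normedAlgebra ℚ_[p] F
  have hp : ProperSpace F := FiniteDimensional.proper ℚ_[p] F
  have hc : IsCompact (padicIntegers p F : Set F) := by
    have : (padicIntegers p F : Set F) = Metric.closedBall 0 1 := by
      ext x
      rw [mem_closedBall_zero_iff]
      exact mem_padicIntegers p F x
    rw [this]
    exact isCompact_closedBall 0 1
  have hcs : CompactSpace (padicIntegers p F) := isCompact_iff_compactSpace.mp hc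
  have ho : IsOpen ((IsLocalRing.maximalIdeal (padicIntegers p F)).toAddSubgroup :
      Set (padicIntegers p F)) := by
    have : ((IsLocalRing.maximalIdeal (padicIntegers p F)).toAddSubgroup :
        Set (padicIntegers p F)) = Subtype.val ⁻¹' Metric.ball (0 : F) 1 := by
      ext x
      rw [Set.mem_preimage, mem_ball_zero_iff]
      exact mem_maximalIdeal_padicIntegers p F x
    rw [this]
    exact Metric.isOpen_ball.preimage continuous_subtype_val
  have hf : Finite (IsLocalRing.ResidueField (padicIntegers p F)) :=
    AddSubgroup.quotient_finite_of_isOpen _ ho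
  exact Nat.card_pos.ne'

instance algebraicClosure_isAlgebraic_padic (p : ℕ) [Fact p.Prime] (F : Type*) [Field F]
    [Algebra ℚ_[p] F] [FiniteDimensional ℚ_[p] F] :
    Algebra.IsAlgebraic ℚ_[p] (AlgebraicClosure F) :=
  Algebra.IsAlgebraic.trans ℚ_[p] F (AlgebraicClosure F)

/-- The absolute Galois group of `F` (which has characteristic zero). -/
abbrev AbsGal (F : Type*) [Field F] : Type _ := AlgebraicClosure F ≃ₐ[F] AlgebraicClosure F

/-- `σ` acts on the residue field of the algebraic closure as the `(a - b)`-th power of the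
arithmetic Frobenius `x ↦ x ^ q`: for every integer `x` of the algebraic closure,
`σ(x) ^ (q ^ b)` and `x ^ (q ^ a)` are congruent modulo the maximal ideal. -/
def ActsAsFrobPow (p : ℕ) [Fact p.Prime] (F : Type*) [Field F] [Algebra ℚ_[p] F]
    [FiniteDimensional ℚ_[p] F] (σ : AbsGal F) (a b : ℕ) : Prop :=
  ∀ x : AlgebraicClosure F, x ∈ padicIntegers p (AlgebraicClosure F) →
    spectralNorm ℚ_[p] (AlgebraicClosure F)
      (σ x ^ (residueCard p F ^ b) - x ^ (residueCard p F ^ a)) < 1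

theorem spectralNorm_absGal (p : ℕ) [Fact p.Prime] (F : Type*) [Field F] [Algebra ℚ_[p] F]
    [FiniteDimensional ℚ_[p] F] (σ : AbsGal F) (x : AlgebraicClosure F) :
    spectralNorm ℚ_[p] (AlgebraicClosure F) (σ x) = spectralNorm ℚ_[p] (AlgebraicClosure F) x :=
  (spectralNorm_eq_of_equiv (σ.restrictScalars ℚ_[p]) x).symm

theorem padic_congr_pow (p : ℕ) [Fact p.Prime] (L : Type*) [Field L] [Algebra ℚ_[p] L]
    [Algebra.IsAlgebraic ℚ_[p] L] {x y : L} (hx : x ∈ padicIntegers p L)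
    (hy : y ∈ padicIntegers p L) (h : spectralNorm ℚ_[p] L (x - y) < 1) (k : ℕ) :
    spectralNorm ℚ_[p] L (x ^ k - y ^ k) < 1 := by
  lift x to padicIntegers p L using hx
  lift y to padicIntegers p L using hy
  obtain ⟨c, hc⟩ := sub_dvd_pow_sub_pow x y k
  have h1 : x - y ∈ IsLocalRing.maximalIdeal (padicIntegers p L) := by
    rw [mem_maximalIdeal_padicIntegers, AddSubgroupClass.coe_sub]; exact h
  have h2 := Ideal.mul_mem_right c _ h1
  rw [← hc, mem_maximalIdeal_padicIntegers, AddSubgroupClass.coe_sub, SubmonoidClass.coe_pow,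
    SubmonoidClass.coe_pow] at h2
  exact h2

theorem padic_congr_trans (p : ℕ) [Fact p.Prime] (L : Type*) [Field L] [Algebra ℚ_[p] L]
    [Algebra.IsAlgebraic ℚ_[p] L] {x y z : L} (h : spectralNorm ℚ_[p] L (x - y) < 1)
    (h' : spectralNorm ℚ_[p] L (y - z) < 1) : spectralNorm ℚ_[p] L (x - z) < 1 := by
  have := isNonarchimedean_spectralNorm (K := ℚ_[p]) (L := L) (x - y) (y - z)
  rw [sub_add_sub_cancel] at this
  exact lt_of_le_of_lt this (max_lt h h')

/-- The Weil group as a subgroup of the absolute Galois group: the elements that act on the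
residue field of the algebraic closure as an integral power of Frobenius. -/
def weilSubgroup (p : ℕ) [Fact p.Prime] (F : Type*) [Field F] [Algebra ℚ_[p] F]
    [FiniteDimensional ℚ_[p] F] : Subgroup (AbsGal F) where
  carrier := {σ | ∃ a b : ℕ, ActsAsFrobPow p F σ a b}
  one_mem' := ⟨0, 0, fun x _ => by simp [spectralNorm_zero]⟩
  mul_mem' := by
    rintro σ τ ⟨a, b, h⟩ ⟨c, d, h'⟩
    refine ⟨c + a, b + d, fun x hx => ?_⟩
    have hτ : τ x ∈ padicIntegers p (AlgebraicClosure F) := by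
      rw [mem_padicIntegers, spectralNorm_absGal]; exact hx
    have hστ : σ (τ x) ∈ padicIntegers p (AlgebraicClosure F) := by
      rw [mem_padicIntegers, spectralNorm_absGal]; exact hτ
    have h1 := padic_congr_pow p _ (pow_mem hστ _) (pow_mem hτ _) (h (τ x) hτ)
      (residueCard p F ^ d)
    have h2 := padic_congr_pow p _ (pow_mem hτ _) (pow_mem hx _) (h' x hx) (residueCard p F ^ a)
    rw [← pow_mul, ← pow_mul] at h1 h2
    rw [mul_comm (residueCard p F ^ a)] at h1
    rw [pow_add, pow_add]
    exact padic_congr_trans p _ h1 h2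
  inv_mem' := by
    rintro σ ⟨a, b, h⟩
    refine ⟨b, a, fun x hx => ?_⟩
    have hσ : σ⁻¹ x ∈ padicIntegers p (AlgebraicClosure F) := by
      rw [mem_padicIntegers, spectralNorm_absGal]; exact hx
    have h1 := h (σ⁻¹ x) hσ
    have h2 : σ (σ⁻¹ x) = x := σ.apply_symm_apply x
    rw [h2, ← neg_sub, spectralNorm_neg (Algebra.IsAlgebraic.isAlgebraic _)] at h1
    exact h1

/-- The Weil group `W_F`. -/
def WeilGroup (p : ℕ) [Fact p.Prime] (F : Type*) [Field F] [Algebra ℚ_[p] F]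
    [FiniteDimensional ℚ_[p] F] : Type _ := weilSubgroup p F

instance (p : ℕ) [Fact p.Prime] (F : Type*) [Field F] [Algebra ℚ_[p] F]
    [FiniteDimensional ℚ_[p] F] : Group (WeilGroup p F) :=
  inferInstanceAs (Group (weilSubgroup p F))

/-- The inclusion of the Weil group in the absolute Galois group. -/
def weilToGal (p : ℕ) [Fact p.Prime] (F : Type*) [Field F] [Algebra ℚ_[p] F]
    [FiniteDimensional ℚ_[p] F] : WeilGroup p F →* AbsGal F :=
  (weilSubgroup p F).subtype

/-- The integer `n` such that `w` acts on the residue field of the algebraic closure as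
`x ↦ x ^ (q ^ n)`. -/
def weilDeg {p : ℕ} [Fact p.Prime] {F : Type*} [Field F] [Algebra ℚ_[p] F]
    [FiniteDimensional ℚ_[p] F] (w : WeilGroup p F) : ℤ :=
  (w.2.choose : ℤ) - (w.2.choose_spec.choose : ℤ)

theorem weilDeg_spec {p : ℕ} [Fact p.Prime] {F : Type*} [Field F] [Algebra ℚ_[p] F]
    [FiniteDimensional ℚ_[p] F] (w : WeilGroup p F) :
    ∃ a b : ℕ, ActsAsFrobPow p F (weilToGal p F w) a b ∧ weilDeg w = (a : ℤ) - b :=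
  ⟨_, _, w.2.choose_spec.choose_spec, rfl⟩

/-- The topology of the Weil group: it is the one induced from the Krull topology and the discrete
topology by `w ↦ (w, weilDeg w)`.  Thus the inertia group `weilDeg w = 0` is open and carries the
Krull topology. -/
instance (p : ℕ) [Fact p.Prime] (F : Type*) [Field F] [Algebra ℚ_[p] F]
    [FiniteDimensional ℚ_[p] F] : TopologicalSpace (WeilGroup p F) :=
  TopologicalSpace.induced (fun w => (weilToGal p F w, weilDeg w)) inferInstance

/-- The absolute value `|w|_F = q ^ n` where `w` acts on the residue field as `x ↦ x ^ (q ^ n)`. -/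
def weilNorm {p : ℕ} [Fact p.Prime] {F : Type*} [Field F] [Algebra ℚ_[p] F]
    [FiniteDimensional ℚ_[p] F] (w : WeilGroup p F) : ℝ :=
  (residueCard p F : ℝ) ^ weilDeg w

theorem weilNorm_pos {p : ℕ} [Fact p.Prime] {F : Type*} [Field F] [Algebra ℚ_[p] F]
    [FiniteDimensional ℚ_[p] F] (w : WeilGroup p F) : 0 < weilNorm w :=
  zpow_pos (Nat.cast_pos.2 (Nat.pos_of_ne_zero (residueCard_ne_zero p F))) _

/-! ### Linear algebraic groups over an algebraically closed field `K` of characteristic zero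

They are represented by their groups of `K`-points, as Zariski closed subgroups of `GL_n(K)`. -/

section AlgGroups

variable {K : Type*} [Field K] {n m : ℕ}

/-- The subset cut out in `GL_n(K)` by polynomial equations in the matrix entries with
coefficients in a field `k`. -/
def ZeroLocusGL (k : Type*) [Field k] [Algebra k K]
    (S : Set (MvPolynomial (Fin n × Fin n) k)) : Set (GL (Fin n) K) :=
  {g | ∀ P ∈ S, MvPolynomial.aeval (fun ij : Fin n × Fin n => g ij.1 ij.2) P = 0}

/-- `H` is Zariski closed in `GL_n(K)`. -/
def IsZariskiClosed (H : Subgroup (GL (Fin n) K)) : Prop :=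
  ∃ S : Set (MvPolynomial (Fin n × Fin n) K), (H : Set (GL (Fin n) K)) = ZeroLocusGL K S

/-- `H` is defined by equations with coefficients in `k` (for `k` of characteristic zero and `K`
an algebraic closure of `k`, this means that `H` is an algebraic group over `k`). -/
def IsDefinedOver (k : Type*) [Field k] [Algebra k K] (H : Subgroup (GL (Fin n) K)) : Prop :=
  ∃ S : Set (MvPolynomial (Fin n × Fin n) k), (H : Set (GL (Fin n) K)) = ZeroLocusGL k S

/-- An algebraic group is connected if it has no proper closed subgroup of finite index. -/
def IsConnectedAlg (H : Subgroup (GL (Fin n) K)) : Prop :=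
  ∀ H' : Subgroup (GL (Fin n) K), H' ≤ H → IsZariskiClosed H' → H'.relIndex H ≠ 0 → H' = H

/-- All elements of `H` are unipotent matrices. -/
def IsUnipotentAlg (H : Subgroup (GL (Fin n) K)) : Prop :=
  ∀ h ∈ H, IsNilpotent ((h : Matrix (Fin n) (Fin n) K) - 1)

/-- `H` is a connected reductive group: it is a connected linear algebraic group, and every
closed connected normal unipotent subgroup of it is trivial. -/
structure IsConnectedReductive (H : Subgroup (GL (Fin n) K)) : Prop where
  closed : IsZariskiClosed H
  connected : IsConnectedAlg H
  reductive : ∀ N : Subgroup (GL (Fin n) K), N ≤ H → IsZariskiClosed N → IsConnectedAlg N →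
    IsUnipotentAlg N → (∀ h ∈ H, ∀ x ∈ N, h * x * h⁻¹ ∈ N) → N = ⊥

/-- The entries of a matrix and of its inverse. -/
def glCoords (g : GL (Fin n) K) : (Fin n × Fin n) ⊕ (Fin n × Fin n) → K :=
  Sum.elim (fun ij => g ij.1 ij.2) (fun ij => g⁻¹ ij.1 ij.2)

/-- Let `X` be embedded by `ι` as a subvariety of `GL_n(K)`.  The map `f : X → GL_m(K)` is a
morphism of varieties: its matrix entries are polynomials in the entries of `ι x` and of
`(ι x)⁻¹`. -/
def IsRegularMap {X : Type*} (ι : X → GL (Fin n) K) (f : X → GL (Fin m) K) : Prop :=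
  ∀ i j : Fin m, ∃ P : MvPolynomial ((Fin n × Fin n) ⊕ (Fin n × Fin n)) K,
    ∀ x : X, f x i j = MvPolynomial.eval (glCoords (ι x)) P

/-- The multiplicative group `K ˣ` as `GL_1(K)`. -/
def gl1 : Kˣ →* GL (Fin 1) K := Matrix.GeneralLinearGroup.scalar (Fin 1)

/-- The upper unipotent matrix with upper right entry `s`. -/
def upperU (s : K) : SL(2, K) := ⟨!![1, s; 0, 1], by simp [Matrix.det_fin_two]⟩

/-- The lower unipotent matrix with lower left entry `s`. -/
def lowerU (s : K) : SL(2, K) := ⟨!![1, 0; s, 1], by simp [Matrix.det_fin_two]⟩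

/-- The matrix `diag(z, z⁻¹)`. -/
def diagSL (z : Kˣ) : SL(2, K) :=
  ⟨!![(z : K), 0; 0, ((z⁻¹ : Kˣ) : K)], by simp [Matrix.det_fin_two]⟩

/-- A torus: a closed connected subgroup that is simultaneously diagonalizable. -/
structure IsTorus (T : Subgroup (GL (Fin n) K)) : Prop where
  closed : IsZariskiClosed T
  connected : IsConnectedAlg T
  diagonalizable : ∃ g : GL (Fin n) K, ∀ t ∈ T,
    ((g * t * g⁻¹ : GL (Fin n) K) : Matrix (Fin n) (Fin n) K).IsDiag

/-- `T` is a maximal torus of `H`. -/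
def IsMaximalTorus (H T : Subgroup (GL (Fin n) K)) : Prop :=
  Maximal (fun T' => IsTorus T' ∧ T' ≤ H) T

/-- `B` is a Borel subgroup of `H`: a maximal closed connected solvable subgroup. -/
def IsBorel (H B : Subgroup (GL (Fin n) K)) : Prop :=
  Maximal (fun B' : Subgroup (GL (Fin n) K) =>
    IsZariskiClosed B' ∧ IsConnectedAlg B' ∧ Group.IsSolvable B' ∧ B' ≤ H) B

/-- The set underlying the character group `X^*(T)`. -/
def CharGp (T : Subgroup (GL (Fin n) K)) : Type _ :=
  {χ : T →* Kˣ // IsRegularMap (fun t : T => (t : GL (Fin n) K)) (fun t => gl1 (χ t))}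

/-- The set underlying the cocharacter group `X_*(T)`. -/
def CocharGp (T : Subgroup (GL (Fin n) K)) : Type _ :=
  {μ : Kˣ →* T // IsRegularMap (gl1 (K := K)) (fun z => (μ z : GL (Fin n) K))}

/-- `Φ : SL_2 → H` is a homomorphism of algebraic groups attached to the root `α` of `(H, T)` with
coroot `μ`: it is nontrivial, restricts to `μ` on diagonal matrices, and maps the upper (lower)
unipotent matrices to the root group of `α` (of `α⁻¹`), `T`-equivariantly.  The existence of such a
`Φ` says that `α` is a root and that `μ` is its coroot. -/
structure IsRootSL2 (H T : Subgroup (GL (Fin n) K)) (α : CharGp T) (μ : CocharGp T)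
    (Φ : SL(2, K) →* H) : Prop where
  regular : IsRegularMap (fun x : SL(2, K) => (x : GL (Fin 2) K))
    (fun x => (Φ x : GL (Fin n) K))
  nontrivial : Φ ≠ 1
  diag : ∀ z : Kˣ, (Φ (diagSL z) : GL (Fin n) K) = μ.1 z
  upper : ∀ (t : T) (s : K), (t : GL (Fin n) K) * Φ (upperU s) * (t : GL (Fin n) K)⁻¹ =
    Φ (upperU ((α.1 t : K) * s))
  lower : ∀ (t : T) (s : K), (t : GL (Fin n) K) * Φ (lowerU s) * (t : GL (Fin n) K)⁻¹ =
    Φ (lowerU ((((α.1 t)⁻¹ : Kˣ) : K) * s))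

/-- `α` is a root of `(H, T)` that is positive for the Borel subgroup `B`, with coroot `μ`. -/
def IsPosRootPair (H B T : Subgroup (GL (Fin n) K)) (α : CharGp T) (μ : CocharGp T) : Prop :=
  ∃ Φ : SL(2, K) →* H, IsRootSL2 H T α μ Φ ∧ ∀ s : K, (Φ (upperU s) : GL (Fin n) K) ∈ B

/-- `α` is a simple root: a positive root that is not the sum of two positive roots
(characters are written multiplicatively). -/
def IsSimpleRoot (H B T : Subgroup (GL (Fin n) K)) (α : CharGp T) : Prop :=
  (∃ μ, IsPosRootPair H B T α μ) ∧
    ¬ ∃ β γ : CharGp T, (∃ μ, IsPosRootPair H B T β μ) ∧ (∃ μ, IsPosRootPair H B T γ μ) ∧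
      α.1 = β.1 * γ.1

/-- A pinning of `(H, B, T)`: the choice, for each simple root, of a homomorphism from `SL_2`
attached to it (equivalently, of a nonzero root vector). -/
structure IsPinning (H B T : Subgroup (GL (Fin n) K)) (Pin : Set (SL(2, K) →* H)) : Prop where
  simple : ∀ Φ ∈ Pin, ∃ α μ, IsSimpleRoot H B T α ∧ IsRootSL2 H T α μ Φ
  unique : ∀ α, IsSimpleRoot H B T α → ∃! Φ, Φ ∈ Pin ∧ ∃ μ, IsRootSL2 H T α μ Φ

end AlgGroups

/-! ### The dual group and the L-group -/

section LGroupDefs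

variable {F : Type*} [Field F] {n m : ℕ}

/-- The action of the absolute Galois group on matrices over the algebraic closure. -/
def galGL (σ : AbsGal F) : GL (Fin n) (AlgebraicClosure F) →* GL (Fin n) (AlgebraicClosure F) :=
  Matrix.GeneralLinearGroup.map (σ : AlgebraicClosure F →+* AlgebraicClosure F)

/-- The based root datum of the complex group `(Gd, Bd, Td)` is identified by `δ` and `ε` with the
dual of the based root datum of `(G, B, T)`: `δ` and `ε` are group isomorphisms
`X^*(T) ≃ X_*(Td)`, `X_*(T) ≃ X^*(Td)`, they respect the pairings, and they exchange positive
roots and positive coroots. -/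
structure IsDualBasedRootDatum
    (G B T : Subgroup (GL (Fin n) (AlgebraicClosure F))) (Gd Bd Td : Subgroup (GL (Fin m) ℂ))
    (δ : CharGp T ≃ CocharGp Td) (ε : CocharGp T ≃ CharGp Td) : Prop where
  map_mul_char : ∀ χ₁ χ₂ χ₃ : CharGp T, (∀ t, χ₃.1 t = χ₁.1 t * χ₂.1 t) →
    ∀ z, (δ χ₃).1 z = (δ χ₁).1 z * (δ χ₂).1 z
  map_mul_cochar : ∀ μ₁ μ₂ μ₃ : CocharGp T, (∀ z, μ₃.1 z = μ₁.1 z * μ₂.1 z) →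
    ∀ t, (ε μ₃).1 t = (ε μ₁).1 t * (ε μ₂).1 t
  pairing : ∀ (χ : CharGp T) (μ : CocharGp T) (k : ℤ),
    (∀ z, χ.1 (μ.1 z) = z ^ k) ↔ (∀ z, (ε μ).1 ((δ χ).1 z) = z ^ k)
  roots : ∀ (α : CharGp T) (μ : CocharGp T),
    IsPosRootPair G B T α μ ↔ IsPosRootPair Gd Bd Td (ε μ) (δ α)

/-- The complex connected reductive group `Gd`, with the action `act` of the absolute Galois group
of `F`, is a Langlands dual group of the connected reductive group `G` over `F`: the Galois group
acts through a finite quotient, by algebraic automorphisms that preserve a pinning of `Gd`, the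
based root datum of `Gd` is dual to that of `G`, and the action on it corresponds to the natural
action of the Galois group on the based root datum of `G`.  The latter sends the character `χ` of
`T` to `σ ∘ χ ∘ σ⁻¹`, followed by transport by an element `g` that conjugates
`(σ(B), σ(T))` to `(B, T)`. -/
structure IsDualGroup (G : Subgroup (GL (Fin n) (AlgebraicClosure F)))
    (Gd : Subgroup (GL (Fin m) ℂ)) (act : AbsGal F →* MulAut Gd) : Prop where
  reductive : IsConnectedReductive Gd
  regular : ∀ σ : AbsGal F, IsRegularMap (fun g : Gd => (g : GL (Fin m) ℂ))
    (fun g => (act σ g : GL (Fin m) ℂ))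
  finite_quotient : IsOpen (act.ker : Set (AbsGal F))
  dual : ∃ (B T : Subgroup (GL (Fin n) (AlgebraicClosure F))) (Bd Td : Subgroup (GL (Fin m) ℂ))
    (δ : CharGp T ≃ CocharGp Td) (ε : CocharGp T ≃ CharGp Td) (Pin : Set (SL(2, ℂ) →* Gd)),
    IsBorel G B ∧ IsMaximalTorus G T ∧ T ≤ B ∧
    IsBorel Gd Bd ∧ IsMaximalTorus Gd Td ∧ Td ≤ Bd ∧
    IsDualBasedRootDatum G B T Gd Bd Td δ ε ∧
    IsPinning Gd Bd Td Pin ∧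
    (∀ (σ : AbsGal F) (g : Gd), (g : GL (Fin m) ℂ) ∈ Bd → (act σ g : GL (Fin m) ℂ) ∈ Bd) ∧
    (∀ (σ : AbsGal F) (g : Gd), (g : GL (Fin m) ℂ) ∈ Td → (act σ g : GL (Fin m) ℂ) ∈ Td) ∧
    (∀ (σ : AbsGal F), ∀ Φ ∈ Pin, (act σ).toMonoidHom.comp Φ ∈ Pin) ∧
    (∀ σ : AbsGal F, ∃ g ∈ G,
      (∀ b ∈ B, g * galGL σ b * g⁻¹ ∈ B) ∧
      (∀ t ∈ T, g * galGL σ t * g⁻¹ ∈ T) ∧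
      ∀ χ χ' : CharGp T,
        (∀ s s' : T, (s' : GL (Fin n) (AlgebraicClosure F)) = g * galGL σ s * g⁻¹ →
          (χ'.1 s' : AlgebraicClosure F) = σ (χ.1 s : AlgebraicClosure F)) →
        ∀ (z : ℂˣ) (y : Gd), (y : GL (Fin m) ℂ) = (δ χ).1 z →
          (act σ y : GL (Fin m) ℂ) = (δ χ').1 z)

end LGroupDefs

section Parameters

variable (p : ℕ) [Fact p.Prime] {F : Type*} [Field F] [Algebra ℚ_[p] F]
  [FiniteDimensional ℚ_[p] F] {m : ℕ} {Gd : Subgroup (GL (Fin m) ℂ)}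

/-- The L-group, the semidirect product of the dual group and the Weil group. -/
abbrev LGroup (act : AbsGal F →* MulAut Gd) : Type _ :=
  Gd ⋊[act.comp (weilToGal p F)] WeilGroup p F

/-- The L-group has the product topology. -/
instance (act : AbsGal F →* MulAut Gd) : TopologicalSpace (LGroup p act) :=
  TopologicalSpace.induced (fun x => (x.left, x.right)) inferInstance

variable {p} {act : AbsGal F →* MulAut Gd}

/-- An element of the L-group is semisimple if it acts semisimply in every finite-dimensional
representation of the L-group that is algebraic on the dual group and trivial on the elements of
the Weil group that fix some finite extension of `F`. -/
def IsSemisimpleElt (x : LGroup p act) : Prop :=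
  ∀ (k : ℕ) (r : LGroup p act →* GL (Fin k) ℂ),
    IsRegularMap (fun g : Gd => (g : GL (Fin m) ℂ)) (fun g => r (SemidirectProduct.inl g)) →
    (∃ U : Subgroup (AbsGal F), IsOpen (U : Set (AbsGal F)) ∧
      ∀ w : WeilGroup p F, weilToGal p F w ∈ U → r (SemidirectProduct.inr w) = 1) →
    Module.End.IsSemisimple (Matrix.toLin' (r x : Matrix (Fin k) (Fin k) ℂ))

/-- A Langlands parameter: a continuous homomorphism `φ : W_F × SL_2(ℂ) → LG` over `W_F` that is
algebraic on `SL_2(ℂ)` and maps Frobenius elements to semisimple elements. -/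
structure IsLanglandsParameter (φ : WeilGroup p F × SL(2, ℂ) →* LGroup p act) : Prop where
  continuous : Continuous φ
  over_weil : ∀ z, (φ z).right = z.1
  algebraic : IsRegularMap (fun x : SL(2, ℂ) => (x : GL (Fin 2) ℂ))
    (fun x => ((φ (1, x)).left : GL (Fin m) ℂ))
  semisimple : ∀ w : WeilGroup p F, weilDeg w = 1 → IsSemisimpleElt (φ (w, 1))

/-- A Langlands parameter is tempered if the image of its restriction to `W_F` is bounded
(relatively compact) in the dual group. -/
def IsTempered (φ : WeilGroup p F × SL(2, ℂ) →* LGroup p act) : Prop :=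
  IsCompact (closure (Set.range fun w : WeilGroup p F => (φ (w, 1)).left))

/-- An Arthur parameter: a continuous homomorphism `ψ : W_F × SL_2(ℂ) × SL_2(ℂ) → LG` over `W_F`
that is algebraic on both copies of `SL_2(ℂ)`, maps Frobenius elements to semisimple elements, and
has bounded image on `W_F`. -/
structure IsArthurParameter (ψ : WeilGroup p F × SL(2, ℂ) × SL(2, ℂ) →* LGroup p act) :
    Prop where
  continuous : Continuous ψ
  over_weil : ∀ z, (ψ z).right = z.1
  algebraic : IsRegularMap (fun x : SL(2, ℂ) => (x : GL (Fin 2) ℂ))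
    (fun x => ((ψ (1, x, 1)).left : GL (Fin m) ℂ))
  algebraic' : IsRegularMap (fun y : SL(2, ℂ) => (y : GL (Fin 2) ℂ))
    (fun y => ((ψ (1, 1, y)).left : GL (Fin m) ℂ))
  semisimple : ∀ w : WeilGroup p F, weilDeg w = 1 → IsSemisimpleElt (ψ (w, 1, 1))
  bounded : IsCompact (closure (Set.range fun w : WeilGroup p F => (ψ (w, 1, 1)).left))

/-- The matrix `d_w = diag(|w|^(1/2), |w|^(-1/2))`. -/
def dWeil (w : WeilGroup p F) : SL(2, ℂ) :=
  diagSL (Units.mk0 ((√(weilNorm w) : ℝ) : ℂ)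
    (Complex.ofReal_ne_zero.2 (Real.sqrt_ne_zero'.2 (weilNorm_pos w))))

/-- `φ` is of Arthur type if `φ(w, x) = ψ(w, x, d_w)` for an Arthur parameter `ψ`. -/
def IsOfArthurType (φ : WeilGroup p F × SL(2, ℂ) →* LGroup p act) : Prop :=
  ∃ ψ : WeilGroup p F × SL(2, ℂ) × SL(2, ℂ) →* LGroup p act,
    IsArthurParameter ψ ∧ ∀ w x, φ (w, x) = ψ (w, x, dWeil w)

/-- The infinitesimal parameter `λ(w) = φ(w, d_w)`. -/
def infParam (φ : WeilGroup p F × SL(2, ℂ) →* LGroup p act) (w : WeilGroup p F) : LGroup p act :=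
  φ (w, dWeil w)

/-- The Lie algebra of a closed complex subgroup `H` of `GL_m(ℂ)`: the matrices `X` such that
`exp(t X)` lies in `H` for all complex `t`. -/
def lieAlg (H : Subgroup (GL (Fin m) ℂ)) : Set (Matrix (Fin m) (Fin m) ℂ) :=
  {X | ∀ t : ℂ, ∃ g ∈ H, (g : Matrix (Fin m) (Fin m) ℂ) = NormedSpace.exp (t • X)}

/-- The one-parameter subgroup `t ↦ exp(t X)` of `H` attached to an element `X` of the Lie algebra
of `H`. -/
def oneParam {H : Subgroup (GL (Fin m) ℂ)} (X : lieAlg H) (t : ℂ) : H :=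
  ⟨(X.2 t).choose, (X.2 t).choose_spec.1⟩

theorem oneParam_val {H : Subgroup (GL (Fin m) ℂ)} (X : lieAlg H) (t : ℂ) :
    ((oneParam X t : GL (Fin m) ℂ) : Matrix (Fin m) (Fin m) ℂ) =
      NormedSpace.exp (t • (X : Matrix (Fin m) (Fin m) ℂ)) :=
  (X.2 t).choose_spec.2

/-- The adjoint action of the L-group on the Lie algebra of the dual group: `Ad(x) X` is the
derivative at `t = 0` of `x exp(t X) x⁻¹`. -/
def adL (x : LGroup p act) (X : lieAlg Gd) : Matrix (Fin m) (Fin m) ℂ :=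
  Matrix.of fun i j => deriv (fun t : ℂ =>
    ((x * SemidirectProduct.inl (oneParam X t) * x⁻¹).left : GL (Fin m) ℂ) i j) 0

/-- The Vogan variety `V_λ` of `λ : W_F → LG`: the elements `X` of the Lie algebra of the dual
group with `Ad(λ(w)) X = |w| X` for all `w`. -/
def voganVariety (lam : WeilGroup p F → LGroup p act) : Set (Matrix (Fin m) (Fin m) ℂ) :=
  {X | ∃ hX : X ∈ lieAlg Gd, ∀ w, adL (lam w) ⟨X, hX⟩ = (weilNorm w : ℂ) • X}

/-- The centralizer `H_λ` of `λ` in the dual group. -/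
def centralizerOf (lam : WeilGroup p F → LGroup p act) : Set Gd :=
  {g | ∀ w, SemidirectProduct.inl g * lam w * (SemidirectProduct.inl g)⁻¹ = lam w}

/-- The orbit of `X` under conjugation by `H_λ`. -/
def voganOrbit (lam : WeilGroup p F → LGroup p act) (X : Matrix (Fin m) (Fin m) ℂ) :
    Set (Matrix (Fin m) (Fin m) ℂ) :=
  {Y | ∃ g ∈ centralizerOf lam, Y = ((g : GL (Fin m) ℂ) : Matrix (Fin m) (Fin m) ℂ) * X *
    (((g : GL (Fin m) ℂ)⁻¹ : GL (Fin m) ℂ) : Matrix (Fin m) (Fin m) ℂ)}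

/-- `C` is a Zariski open subset of the closed subvariety `V` of the space of matrices. -/
def IsZariskiOpenIn (V C : Set (Matrix (Fin m) (Fin m) ℂ)) : Prop :=
  ∃ S : Set (MvPolynomial (Fin m × Fin m) ℂ),
    C = {X | X ∈ V ∧ ∃ P ∈ S, MvPolynomial.eval (fun ij : Fin m × Fin m => X ij.1 ij.2) P ≠ 0}

/-- The point `x_φ = dφ(0 1; 0 0)` of the Vogan variety attached to `φ`. -/
def pointOf (φ : WeilGroup p F × SL(2, ℂ) →* LGroup p act) : Matrix (Fin m) (Fin m) ℂ :=
  Matrix.of fun i j => deriv (fun t : ℂ => ((φ (1, upperU t)).left : GL (Fin m) ℂ) i j) 0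

/-- A Langlands parameter is open if the `H_λ`-orbit of `x_φ` is open in `V_λ`, where `λ` is its
infinitesimal parameter. -/
def IsOpenParameter (φ : WeilGroup p F × SL(2, ℂ) →* LGroup p act) : Prop :=
  IsZariskiOpenIn (voganVariety (infParam φ)) (voganOrbit (infParam φ) (pointOf φ))

end Parameters

end

/-! Write `λ(w) = φ(w, 1) φ(1, d_w)`, and let `(e, h, f)` be the `sl₂`-triple of `φ` restricted to
`SL₂`, so that `x_φ = e`.

Tempered implies Arthur type: let the second `SL₂` act trivially.

Tempered implies open: suppose `Ad(λ(w)) X = |w| X`. A suitable power of `φ(w, 1)` acts on the Lie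
algebra as conjugation by an element of a bounded set, so the growth of `|w|` must come from `φ(1,
d_w)` alone. Hence `X` has weight `2` for the torus of `SL₂` and is fixed by all `φ(w, 1)`
(`isInvariantOfWeight_two`). By `sl₂`-theory `ad e ∘ ad f` is bijective on these vectors
(`exists_bracket_bracket_eq`), and `ad f` sends them to invariants of weight `0`, which are fixed by
`λ` and exponentiate into `H_λ`. So the tangent space of the orbit of `e` is all of `V_λ`, and the
orbit is Zariski open (`isZariskiOpenIn_orbit`). That lemma combines the inverse function theorem
with the connectedness of a complex line minus finitely many points.

Open and Arthur type implies tempered: let `(eᵢ, hᵢ, fᵢ)` be the triples of the two copies of `SL₂`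
under `ψ`. Both `e₁ = x_φ` and `e₂` lie in `V_λ`, so by openness `e₁ + t e₂` is conjugate to `e₁`
for some `t ≠ 0`. The number `tr h²` depends only on the nilpositive element of a triple
(`trace_sq_eq_of_same_e`), and `h₁ + h₂` is a neutral element for `e₁ + t e₂`. Hence `tr (h₁ + h₂)²
= tr h₁²`. Since `tr h₁h₂ = 0`, this gives `tr h₂² = 0`. The eigenvalues of `h₂` are integers, so
`ψ` is trivial on the second torus, and `φ(w, 1) = ψ(w, 1, d_w) = ψ(w, 1, 1)` is bounded. -/

noncomputable section

/-! ### Exponentials in Banach algebras: one-parameter groups, the Lie product formula, local orbits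
-/

section BanachAlgebra

open NormedSpace Filter Topology

theorem norm_pow_le_of_norm_sub_one_le {A : Type*} [NormedRing A] {a : A} {r : ℝ} (ha : ‖a - 1‖ ≤ r) (k : ℕ) :
    ‖a ^ k‖ ≤ ‖(1 : A)‖ * (1 + r) ^ k := by
  have hr : 0 ≤ r := (norm_nonneg _).trans ha
  induction k with
  | zero => simp
  | succ k ih =>
    have h1 : a ^ (k + 1) = a ^ k + a ^ k * (a - 1) := by rw [pow_succ]; noncomm_ring
    calc ‖a ^ (k + 1)‖ ≤ ‖a ^ k‖ + ‖a ^ k‖ * ‖a - 1‖ := by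
          rw [h1]; exact (norm_add_le _ _).trans (by gcongr; exact norm_mul_le _ _)
      _ ≤ ‖a ^ k‖ + ‖a ^ k‖ * r := by gcongr
      _ = ‖a ^ k‖ * (1 + r) := by ring
      _ ≤ ‖(1 : A)‖ * (1 + r) ^ k * (1 + r) := by gcongr
      _ = _ := by ring

/-- Telescoping. The factor `k` is harmless in the Lie product formula, where `‖a - b‖` is `o(1/k)`
and `r` is `O(1/k)`. The factor `‖1‖` appears because the norm of `1` is not assumed to be `1`. -/
theorem norm_pow_sub_pow_le {A : Type*} [NormedRing A] {a b : A} {r : ℝ} (ha : ‖a - 1‖ ≤ r) (hb : ‖b - 1‖ ≤ r) (k : ℕ) :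
    ‖a ^ k - b ^ k‖ ≤ k * (‖(1 : A)‖ * (1 + r) ^ k * ‖a - b‖) := by
  have hr : 0 ≤ r := (norm_nonneg _).trans ha
  induction k with
  | zero => simp
  | succ k ih =>
    have h1 : a ^ (k + 1) - b ^ (k + 1) =
        a ^ k * (a - b) + ((a ^ k - b ^ k) + (a ^ k - b ^ k) * (b - 1)) := by
      rw [pow_succ, pow_succ]; noncomm_ring
    have h2 := norm_pow_le_of_norm_sub_one_le ha k
    set M := ‖(1 : A)‖ * (1 + r) ^ k with hM
    have hM0 : 0 ≤ M := by positivity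
    calc ‖a ^ (k + 1) - b ^ (k + 1)‖
        ≤ ‖a ^ k‖ * ‖a - b‖ + (‖a ^ k - b ^ k‖ + ‖a ^ k - b ^ k‖ * ‖b - 1‖) := by
          rw [h1]
          refine (norm_add_le _ _).trans (add_le_add (norm_mul_le _ _) ?_)
          exact (norm_add_le _ _).trans (by gcongr; exact norm_mul_le _ _)
      _ ≤ M * ‖a - b‖ + (k * (M * ‖a - b‖) + k * (M * ‖a - b‖) * r) := by gcongr
      _ ≤ ((k : ℝ) + 1) * (M * (1 + r) * ‖a - b‖) := by
          have : 0 ≤ M * ‖a - b‖ * r := by positivity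
          linarith
      _ = ((k + 1 : ℕ) : ℝ) * (‖(1 : A)‖ * (1 + r) ^ (k + 1) * ‖a - b‖) := by
          push_cast; rw [hM]; ring

variable {A : Type*} [NormedRing A] [NormedAlgebra ℂ A] [CompleteSpace A]

/-- A one-parameter group that is differentiable at `0` is an exponential. -/
theorem oneParam_eq_exp_of_hasDerivAt {f : ℂ → A} {X : A} (hmul : ∀ s t, f (s + t) = f s * f t)
    (h0 : f 0 = 1) (hd : HasDerivAt f X 0) (t : ℂ) : f t = exp (t • X) := by
  -- The group law moves the derivative at `0` to every `t`, giving `f' = f X`; then `f(t) exp(-tX)`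
  -- has derivative zero.
  have hd' : ∀ t, HasDerivAt f (f t * X) t := fun t => by
    have h1 : HasDerivAt (fun s => f (s - t)) X t :=
      HasDerivAt.comp_sub_const (f := f) t t (by rwa [sub_self])
    have h2 := h1.const_mul (f t)
    refine h2.congr_of_eventuallyEq (Eventually.of_forall fun s => ?_)
    change f s = f t * f (s - t)
    rw [← hmul, add_sub_cancel]
  have hE : ∀ t : ℂ, HasDerivAt (fun s : ℂ => exp (s • (-X))) (-X * exp (t • (-X))) t :=
    fun t => hasDerivAt_exp_smul_const' (𝕂 := ℂ) (-X) t
  have hc : ∀ t, HasDerivAt (fun s => f s * exp (s • (-X))) 0 t := fun t => by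
    have := (hd' t).mul (hE t)
    rwa [show f t * X * exp (t • -X) + f t * (-X * exp (t • -X)) = 0 by
      rw [neg_mul, mul_neg, mul_assoc, add_neg_cancel]] at this
  have hk := is_const_of_deriv_eq_zero (fun t => (hc t).differentiableAt) (fun t => (hc t).deriv) t 0
  simp only [h0, zero_smul, NormedSpace.exp_zero, mul_one] at hk
  have hinv : exp (t • (-X)) * exp (t • X) = 1 := by
    let _ : NormedAlgebra ℚ A := .restrictScalars ℚ ℂ A
    rw [smul_neg, ← NormedSpace.exp_add_of_commute (Commute.neg_left (Commute.refl _)), neg_add_cancel,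
      NormedSpace.exp_zero]
  calc f t = f t * (exp (t • (-X)) * exp (t • X)) := by rw [hinv, mul_one]
    _ = exp (t • X) := by rw [← mul_assoc, hk, one_mul]

/-- The Lie product formula. -/
theorem tendsto_exp_mul_exp_pow (X Y : A) :
    Tendsto (fun n : ℕ => (exp ((n : ℂ)⁻¹ • X) * exp ((n : ℂ)⁻¹ • Y)) ^ n) atTop
      (𝓝 (exp (X + Y))) := by
  let _ : NormedAlgebra ℚ A := .restrictScalars ℚ ℂ A
  set a : ℂ → A := fun t => exp (t • X) * exp (t • Y)
  set b : ℂ → A := fun t => exp (t • (X + Y))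
  have ha : HasDerivAt a (X + Y) 0 := by
    have := (hasDerivAt_exp_smul_const (𝕂 := ℂ) X 0).mul (hasDerivAt_exp_smul_const (𝕂 := ℂ) Y 0)
    simp only [zero_smul, NormedSpace.exp_zero, one_mul, mul_one] at this
    exact this
  have hb : HasDerivAt b (X + Y) 0 := by
    simpa only [zero_smul, NormedSpace.exp_zero, one_mul] using
      hasDerivAt_exp_smul_const (𝕂 := ℂ) (X + Y) 0
  have ha0 : a 0 = 1 := by simp [a]
  have hb0 : b 0 = 1 := by simp [b]
  have hinv : Tendsto (fun n : ℕ => (n : ℂ)⁻¹) atTop (𝓝[≠] 0) := by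
    refine tendsto_nhdsWithin_iff.2 ⟨tendsto_inv₀_cobounded.comp ?_, ?_⟩
    · exact tendsto_norm_atTop_iff_cobounded.1 (by simpa using tendsto_natCast_atTop_atTop)
    · filter_upwards [eventually_gt_atTop 0] with n hn
      simpa using hn.ne'
  have slope_lim : ∀ {f : ℂ → A} {Z : A}, HasDerivAt f Z 0 →
      Tendsto (fun n : ℕ => (n : ℂ) • (f (n : ℂ)⁻¹ - f 0)) atTop (𝓝 Z) := fun {f Z} hf => by
    have := (hasDerivAt_iff_tendsto_slope.1 hf).comp hinv
    refine this.congr fun n => ?_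
    simp [slope_def_module]
  have hna := slope_lim ha
  have hnb := slope_lim hb
  rw [ha0] at hna
  rw [hb0] at hnb
  have hnab : Tendsto (fun n : ℕ => ‖(n : ℂ) • (a (n : ℂ)⁻¹ - b (n : ℂ)⁻¹)‖) atTop (𝓝 0) := by
    have := (hna.sub hnb).norm
    simp only [sub_self, norm_zero] at this
    refine this.congr fun n => ?_
    rw [← smul_sub]
    congr 2
    abel
  -- Any constant above `‖X + Y‖`, the limit of `n ‖f(1/n) - 1‖` for both curves, would do.
  set C := ‖X + Y‖ + 1
  have hC : ∀ {f : ℂ → A}, Tendsto (fun n : ℕ => (n : ℂ) • (f (n : ℂ)⁻¹ - 1)) atTop (𝓝 (X + Y)) →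
      ∀ᶠ n : ℕ in atTop, ‖f (n : ℂ)⁻¹ - 1‖ ≤ C / n := fun {f} hf => by
    filter_upwards [hf.norm.eventually (gt_mem_nhds (lt_add_one ‖X + Y‖)), eventually_gt_atTop 0]
      with n hn hn0
    rw [norm_smul, Complex.norm_natCast] at hn
    rw [le_div_iff₀ (by exact_mod_cast hn0), mul_comm]
    exact hn.le
  -- `exp (X + Y)` is the `n`-th power of `b(1/n)`, and `(1 + C/n)^n ≤ e^C`. What remains is `n
  -- ‖a(1/n) - b(1/n)‖`, which tends to `0` since `a` and `b` have the same derivative at `0`.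
  have key : ∀ᶠ n : ℕ in atTop, ‖a (n : ℂ)⁻¹ ^ n - exp (X + Y)‖ ≤
      (‖(1 : A)‖ * Real.exp C) * ‖(n : ℂ) • (a (n : ℂ)⁻¹ - b (n : ℂ)⁻¹)‖ := by
    filter_upwards [hC hna, hC hnb, eventually_gt_atTop 0] with n h1 h2 hn0
    have hbn : b (n : ℂ)⁻¹ ^ n = exp (X + Y) := by
      have hn' : (n : ℂ) ≠ 0 := by exact_mod_cast hn0.ne'
      simp only [b]
      rw [← NormedSpace.exp_nsmul, ← Nat.cast_smul_eq_nsmul ℂ, smul_smul, mul_inv_cancel₀ hn', one_smul]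
    have h3 := norm_pow_sub_pow_le h1 h2 n
    rw [hbn] at h3
    have h4 : (1 + C / n) ^ n ≤ Real.exp C := by
      have hn' : (n : ℝ) ≠ 0 := by exact_mod_cast hn0.ne'
      calc (1 + C / n) ^ n ≤ Real.exp (C / n) ^ n := by
            gcongr
            rw [add_comm]; exact Real.add_one_le_exp _
        _ = Real.exp C := by rw [← Real.exp_nat_mul, mul_div_cancel₀ _ hn']
    rw [norm_smul, Complex.norm_natCast]
    calc _ ≤ _ := h3
      _ ≤ n * (‖(1 : A)‖ * Real.exp C * ‖a (n : ℂ)⁻¹ - b (n : ℂ)⁻¹‖) := by gcongr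
      _ = _ := by ring
  rw [tendsto_iff_norm_sub_tendsto_zero]
  refine squeeze_zero' (Eventually.of_forall fun _ => norm_nonneg _) key ?_
  simpa using hnab.const_mul (‖(1 : A)‖ * Real.exp C)

/-- The orbit map `X ↦ exp X * Y * exp (-X)` has strict derivative `X ↦ X * Y - Y * X` at `0`. -/
theorem hasStrictFDerivAt_exp_conj (Y : A) :
    HasStrictFDerivAt (fun X : A => exp X * Y * exp (-X))
      (((ContinuousLinearMap.mul ℂ A).flip Y - ContinuousLinearMap.mul ℂ A Y : A →L[ℂ] A)) 0 := by
  have h1 : HasStrictFDerivAt (exp : A → A) (1 : A →L[ℂ] A) 0 := hasStrictFDerivAt_exp_zero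
  have h2 : HasStrictFDerivAt (fun X : A => exp (-X)) (-1 : A →L[ℂ] A) 0 := by
    have h1' : HasStrictFDerivAt (exp : A → A) (1 : A →L[ℂ] A) (-0) := by rwa [neg_zero]
    exact (h1'.comp (0 : A) (hasStrictFDerivAt_id (𝕜 := ℂ) (0 : A)).neg).congr_fderiv
      (by ext; simp)
  refine ((h1.mul' (hasStrictFDerivAt_const Y 0)).mul' h2).congr_fderiv ?_
  ext X
  simp [sub_eq_neg_add]

/-- If the tangent space at `Y` of the orbit of `Y` is `V`, then the orbit contains a neighbourhood
of `Y` in `V`. -/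
theorem eventually_exists_exp_conj [FiniteDimensional ℂ A] (h V : Submodule ℂ A) (Y : V)
    (hV : ∀ X ∈ h, exp X * (Y : A) * exp (-X) ∈ V)
    (hsurj : ∀ Z ∈ V, ∃ X ∈ h, X * (Y : A) - Y * X = Z) :
    ∀ᶠ Z : V in 𝓝 Y, ∃ X ∈ h, (Z : A) = exp X * (Y : A) * exp (-X) := by
  -- Composing with a projection onto `V` gives a map between `h` and `V` with surjective strict
  -- derivative, to which the open mapping form of the inverse function theorem applies. By `hV` the
  -- projection changes nothing.
  obtain ⟨π, hπ⟩ := Submodule.ClosedComplemented.of_finiteDimensional V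
  set f : h → V := fun X => π (exp (X : A) * (Y : A) * exp (-(X : A)))
  have hf : HasStrictFDerivAt f (π ∘L (((ContinuousLinearMap.mul ℂ A).flip (Y : A) -
      ContinuousLinearMap.mul ℂ A Y : A →L[ℂ] A) ∘L h.subtypeL)) 0 :=
    π.hasStrictFDerivAt.comp (0 : h)
      ((hasStrictFDerivAt_exp_conj (Y : A)).comp (0 : h) h.subtypeL.hasStrictFDerivAt)
  have hs : (π ∘L (((ContinuousLinearMap.mul ℂ A).flip (Y : A) -
      ContinuousLinearMap.mul ℂ A Y : A →L[ℂ] A) ∘L h.subtypeL)).range = ⊤ := by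
    rw [LinearMap.range_eq_top]
    intro Z
    obtain ⟨X, hX, hXZ⟩ := hsurj Z Z.2
    refine ⟨⟨X, hX⟩, ?_⟩
    have : π (X * (Y : A) - Y * X) = Z := by rw [hXZ]; exact hπ Z
    simpa using this
  have hmap := hf.map_nhds_eq_of_surj hs
  have hf0 : f 0 = Y := by simp [f, hπ]
  rw [hf0] at hmap
  rw [← hmap]
  refine Filter.eventually_map.2 (Eventually.of_forall fun X => ⟨X, X.2, ?_⟩)
  have := hπ ⟨_, hV X X.2⟩
  simp only [f, this]

end BanachAlgebra

/-! ### Matrix exponentials and differentials of regular homomorphisms -/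

section MatrixExp

open NormedSpace Filter Topology

attribute [local instance] Matrix.linftyOpNormedRing Matrix.linftyOpNormedAlgebra

variable {m n : ℕ}

theorem Matrix.hasDerivAt_iff_entries {f : ℂ → Matrix (Fin m) (Fin m) ℂ}
    {X : Matrix (Fin m) (Fin m) ℂ} {t : ℂ} :
    HasDerivAt f X t ↔ ∀ i j, HasDerivAt (fun s => f s i j) (X i j) t := by
  have h1 := hasDerivAt_pi (𝕜 := ℂ) (x := t) (φ := fun s i => f s i) (φ' := fun i => X i)
  have h2 := fun i => hasDerivAt_pi (𝕜 := ℂ) (x := t) (φ := fun s j => f s i j)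
    (φ' := fun j => X i j)
  exact h1.trans (forall_congr' h2)

theorem Matrix.hasDerivAt_exp_smul_zero (X : Matrix (Fin m) (Fin m) ℂ) :
    HasDerivAt (fun t : ℂ => exp (t • X)) X 0 := by
  have := hasDerivAt_exp_smul_const (𝕂 := ℂ) X 0
  simp only [zero_smul, NormedSpace.exp_zero, one_mul] at this
  exact this

/-- Differentiate at `0`. This is the device that turns identities in the group into identities in
the Lie algebra. -/
theorem Matrix.eq_of_exp_smul_eq {X Y : Matrix (Fin m) (Fin m) ℂ}
    (h : ∀ t : ℂ, exp (t • X) = exp (t • Y)) : X = Y :=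
  (Matrix.hasDerivAt_exp_smul_zero X).unique
    ((Matrix.hasDerivAt_exp_smul_zero Y).congr_of_eventuallyEq (Eventually.of_forall h))

theorem Matrix.deriv_exp_smul_entry (X : Matrix (Fin m) (Fin m) ℂ) (i j : Fin m) :
    deriv (fun t : ℂ => exp (t • X) i j) 0 = X i j :=
  (Matrix.hasDerivAt_iff_entries.1 (Matrix.hasDerivAt_exp_smul_zero X) i j).deriv

theorem Matrix.exp_neg_mul_exp (X : Matrix (Fin m) (Fin m) ℂ) : exp (-X) * exp X = 1 := by
  rw [← Matrix.exp_add_of_commute _ _ (Commute.neg_left (Commute.refl X)), neg_add_cancel,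
    NormedSpace.exp_zero]

theorem Matrix.exp_mul_exp_neg (X : Matrix (Fin m) (Fin m) ℂ) : exp X * exp (-X) = 1 := by
  simpa using Matrix.exp_neg_mul_exp (-X)

theorem Matrix.exp_add_smul (s t : ℂ) (X : Matrix (Fin m) (Fin m) ℂ) :
    exp ((s + t) • X) = exp (s • X) * exp (t • X) := by
  rw [add_smul, Matrix.exp_add_of_commute]
  exact ((Commute.refl X).smul_left s).smul_right t

theorem Matrix.hasDerivAt_exp_conj (X Y : Matrix (Fin m) (Fin m) ℂ) :
    HasDerivAt (fun t : ℂ => exp (t • X) * Y * exp (-(t • X))) (X * Y - Y * X) 0 := by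
  have h1 := Matrix.hasDerivAt_exp_smul_zero X
  have h2 := Matrix.hasDerivAt_exp_smul_zero (-X)
  have := (h1.mul_const Y).mul h2
  simp only [zero_smul, NormedSpace.exp_zero, one_mul, mul_one] at this
  simp only [← smul_neg]
  rwa [mul_neg, ← sub_eq_add_neg] at this

theorem coe_inv_of_coe_eq_exp {g : GL (Fin m) ℂ} {X : Matrix (Fin m) (Fin m) ℂ}
    (h : (g : Matrix (Fin m) (Fin m) ℂ) = exp X) :
    ((g⁻¹ : GL (Fin m) ℂ) : Matrix (Fin m) (Fin m) ℂ) = exp (-X) := by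
  calc ((g⁻¹ : GL (Fin m) ℂ) : Matrix (Fin m) (Fin m) ℂ)
      = (g⁻¹ : GL (Fin m) ℂ).val * (exp X * exp (-X)) := by rw [Matrix.exp_mul_exp_neg, mul_one]
    _ = exp (-X) := by rw [← mul_assoc, ← h, Units.inv_mul, one_mul]

theorem GL_conj_exp (g : GL (Fin m) ℂ) (X : Matrix (Fin m) (Fin m) ℂ) :
    exp (g.val * X * (g⁻¹ : GL (Fin m) ℂ).val) = g.val * exp X * (g⁻¹ : GL (Fin m) ℂ).val :=
  NormedSpace.exp_units_conj g X

/-- Conjugation by an invertible matrix. -/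
def conjGL (g : GL (Fin m) ℂ) : Matrix (Fin m) (Fin m) ℂ →ₗ[ℂ] Matrix (Fin m) (Fin m) ℂ where
  toFun X := g.val * X * (g⁻¹ : GL (Fin m) ℂ).val
  map_add' X Y := by rw [mul_add, add_mul]
  map_smul' c X := by simp

theorem conjGL_apply (g : GL (Fin m) ℂ) (X : Matrix (Fin m) (Fin m) ℂ) :
    conjGL g X = g.val * X * (g⁻¹ : GL (Fin m) ℂ).val := rfl

theorem conjGL_mul (g h : GL (Fin m) ℂ) (X : Matrix (Fin m) (Fin m) ℂ) :
    conjGL (g * h) X = conjGL g (conjGL h X) := by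
  simp only [conjGL_apply, _root_.mul_inv_rev, Units.val_mul, mul_assoc]

theorem exp_smul_conjGL (g : GL (Fin m) ℂ) (X : Matrix (Fin m) (Fin m) ℂ) (t : ℂ) :
    exp (t • conjGL g X) = g.val * exp (t • X) * (g⁻¹ : GL (Fin m) ℂ).val := by
  rw [← map_smul, conjGL_apply, GL_conj_exp]

theorem conjGL_bracket (g : GL (Fin m) ℂ) (X Y : Matrix (Fin m) (Fin m) ℂ) :
    conjGL g (X * Y - Y * X) = conjGL g X * conjGL g Y - conjGL g Y * conjGL g X := by
  rw [map_sub]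
  simp only [conjGL_apply, mul_assoc, Units.inv_mul_cancel_left]

theorem conjGL_of_coe_eq_exp {g : GL (Fin m) ℂ} {Y : Matrix (Fin m) (Fin m) ℂ}
    (h : (g : Matrix (Fin m) (Fin m) ℂ) = exp Y) (X : Matrix (Fin m) (Fin m) ℂ) :
    conjGL g X = exp Y * X * exp (-Y) := by
  rw [conjGL_apply, coe_inv_of_coe_eq_exp h, h]

/-- A polynomial is differentiable along curves, with derivative linear in the direction. -/
theorem MvPolynomial.exists_hasDerivAt {ι : Type*} [Finite ι] (P : MvPolynomial ι ℂ) (a : ι → ℂ) :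
    ∃ L : (ι → ℂ) →ₗ[ℂ] ℂ, ∀ (c : ℂ → ι → ℂ) (v : ι → ℂ), c 0 = a →
      (∀ i, HasDerivAt (fun t => c t i) (v i) 0) →
      HasDerivAt (fun t => MvPolynomial.eval (c t) P) (L v) 0 := by
  induction P using MvPolynomial.induction_on with
  | C r => exact ⟨0, fun c v _ _ => by simpa using hasDerivAt_const (0 : ℂ) r⟩
  | add P Q hP hQ =>
    obtain ⟨L, hL⟩ := hP
    obtain ⟨L', hL'⟩ := hQ
    refine ⟨L + L', fun c v h0 hc => ?_⟩
    simp only [map_add]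
    exact (hL c v h0 hc).add (hL' c v h0 hc)
  | mul_X P i hP =>
    obtain ⟨L, hL⟩ := hP
    refine ⟨a i • L + MvPolynomial.eval a P • LinearMap.proj i, fun c v h0 hc => ?_⟩
    have := (hL c v h0 hc).mul (hc i)
    simp only [map_mul, MvPolynomial.eval_X]
    refine this.congr_deriv ?_
    simp [h0, mul_comm]

/-- `d` is the differential of the homomorphism `f` of groups of matrices: `f` sends
`exp (t X)` to `exp (t d(X))`. -/
def IsDifferential {K : Type*} [Group K] (ι : K →* GL (Fin n) ℂ) (f : K →* GL (Fin m) ℂ)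
    (d : Matrix (Fin n) (Fin n) ℂ →ₗ[ℂ] Matrix (Fin m) (Fin m) ℂ) : Prop :=
  ∀ (X : Matrix (Fin n) (Fin n) ℂ) (c : ℂ → K), (∀ t, (ι (c t)).val = exp (t • X)) →
    ∀ t, (f (c t)).val = exp (t • d X)

/-- A homomorphism that is a morphism of varieties has a differential. -/
theorem IsRegularMap.exists_isDifferential {K : Type*} [Group K] {ι : K →* GL (Fin n) ℂ}
    {f : K →* GL (Fin m) ℂ} (hf : IsRegularMap ι f) : ∃ d, IsDifferential ι f d := by
  choose P hP using hf
  choose L hL using fun i j => (P i j).exists_hasDerivAt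
    (Sum.elim (fun ij : Fin n × Fin n => (1 : Matrix (Fin n) (Fin n) ℂ) ij.1 ij.2)
      (fun ij => (1 : Matrix (Fin n) (Fin n) ℂ) ij.1 ij.2))
  -- The velocity at `t = 0` of the coordinates of `exp(tX)` and of its inverse `exp(-tX)`.
  let D : Matrix (Fin n) (Fin n) ℂ →ₗ[ℂ] ((Fin n × Fin n) ⊕ (Fin n × Fin n) → ℂ) :=
    { toFun := fun X => Sum.elim (fun ij => X ij.1 ij.2) (fun ij => -X ij.1 ij.2)
      map_add' := fun X Y => by ext (x | x) <;> simp [add_comm]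
      map_smul' := fun c X => by ext (x | x) <;> simp }
  let d : Matrix (Fin n) (Fin n) ℂ →ₗ[ℂ] Matrix (Fin m) (Fin m) ℂ :=
    { toFun := fun X => Matrix.of fun i j => L i j (D X)
      map_add' := fun X Y => by ext; simp
      map_smul' := fun c X => by ext; simp }
  refine ⟨d, fun X c hc => ?_⟩
  -- The curve `c` need not be a homomorphism, and `ι` need not be injective; regularity makes `f`
  -- depend only on `ι`, which suffices for the group law of `f ∘ c`.
  have hf_eq : ∀ x y : K, ι x = ι y → (f x).val = (f y).val := fun x y h => by
    ext i j
    rw [hP, hP, h]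
  have hcoord : ∀ t, glCoords (ι (c t)) = Sum.elim (fun ij => exp (t • X) ij.1 ij.2)
      (fun ij => exp (t • -X) ij.1 ij.2) := fun t => by
    rw [glCoords, coe_inv_of_coe_eq_exp (hc t), hc t, smul_neg]
  refine oneParam_eq_exp_of_hasDerivAt (fun s t => ?_) ?_ ?_
  · rw [hf_eq (c (s + t)) (c s * c t), map_mul, Units.val_mul]
    refine Units.ext ?_
    rw [map_mul, Units.val_mul, hc, hc, hc, Matrix.exp_add_smul]
  · rw [hf_eq (c 0) 1, map_one, Units.val_one]
    refine Units.ext ?_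
    rw [hc, map_one, zero_smul, NormedSpace.exp_zero, Units.val_one]
  · refine Matrix.hasDerivAt_iff_entries.2 fun i j => ?_
    refine (hL i j (fun t => glCoords (ι (c t))) (D X) ?_ ?_).congr_of_eventuallyEq
      (Eventually.of_forall fun t => hP i j (c t))
    · simp only [hcoord, zero_smul, NormedSpace.exp_zero]
    · rintro (x | x)
      · simp only [hcoord, Sum.elim_inl]
        exact Matrix.hasDerivAt_iff_entries.1 (Matrix.hasDerivAt_exp_smul_zero X) x.1 x.2
      · simp only [hcoord, Sum.elim_inr]
        exact Matrix.hasDerivAt_iff_entries.1 (Matrix.hasDerivAt_exp_smul_zero (-X)) x.1 x.2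

namespace IsDifferential

variable {K : Type*} [Group K] {ι : K →* GL (Fin n) ℂ} {f : K →* GL (Fin m) ℂ}
  {d : Matrix (Fin n) (Fin n) ℂ →ₗ[ℂ] Matrix (Fin m) (Fin m) ℂ}

theorem map_conj (hd : IsDifferential ι f d) {X : Matrix (Fin n) (Fin n) ℂ} {c : ℂ → K}
    (hc : ∀ t, (ι (c t)).val = exp (t • X)) (g : K) :
    d (conjGL (ι g) X) = conjGL (f g) (d X) := by
  refine Matrix.eq_of_exp_smul_eq fun t => ?_
  rw [← hd (conjGL (ι g) X) (fun t => g * c t * g⁻¹) (fun t => ?_) t, exp_smul_conjGL, ← hd X c hc]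
  · simp
  · rw [exp_smul_conjGL, ← hc]
    simp

/-- The derivative at `t = 0` of `map_conj` along the curve `c`. -/
theorem map_bracket (hd : IsDifferential ι f d) {X Y : Matrix (Fin n) (Fin n) ℂ} {c b : ℂ → K}
    (hc : ∀ t, (ι (c t)).val = exp (t • X)) (hb : ∀ t, (ι (b t)).val = exp (t • Y)) :
    d (X * Y - Y * X) = d X * d Y - d Y * d X := by
  have h1 := Matrix.hasDerivAt_exp_conj X Y
  have h2 := Matrix.hasDerivAt_exp_conj (d X) (d Y)
  have h3 := (LinearMap.toContinuousLinearMap d).hasFDerivAt.comp_hasDerivAt (0 : ℂ) h1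
  refine h3.unique (h2.congr_of_eventuallyEq (Eventually.of_forall fun t => ?_))
  have := hd.map_conj hb (c t)
  rwa [conjGL_of_coe_eq_exp (hc t), conjGL_of_coe_eq_exp (hd X c hc t)] at this

end IsDifferential

end MatrixExp

/-! ### The Lie algebra of a Zariski closed group -/

section LieAlgebra

open NormedSpace Filter Topology

attribute [local instance] Matrix.linftyOpNormedRing Matrix.linftyOpNormedAlgebra

variable {m : ℕ} {H : Subgroup (GL (Fin m) ℂ)}

theorem IsZariskiClosed.mem_of_tendsto (hH : IsZariskiClosed H) {u : ℕ → GL (Fin m) ℂ}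
    {g : GL (Fin m) ℂ} (hu : ∀ n, u n ∈ H) (hg : Tendsto (fun n => (u n).val) atTop (𝓝 g.val)) :
    g ∈ H := by
  obtain ⟨S, hS⟩ := hH
  rw [← SetLike.mem_coe, hS]
  intro P hP
  have hcont : Continuous fun M : Matrix (Fin m) (Fin m) ℂ =>
      MvPolynomial.aeval (fun ij : Fin m × Fin m => M ij.1 ij.2) P := by
    have h : Continuous fun M : Matrix (Fin m) (Fin m) ℂ => fun ij : Fin m × Fin m => M ij.1 ij.2 :=
      continuous_pi fun ij => continuous_id.matrix_elem ij.1 ij.2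
    exact (MvPolynomial.continuous_eval P).comp h
  refine tendsto_nhds_unique ((hcont.tendsto g.val).comp hg) ?_
  refine tendsto_const_nhds.congr fun n => ?_
  have : u n ∈ (H : Set (GL (Fin m) ℂ)) := hu n
  rw [hS] at this
  exact (this P hP).symm

theorem exists_mem_coe_eq_exp {X : Matrix (Fin m) (Fin m) ℂ} (hX : X ∈ lieAlg H) :
    ∃ g ∈ H, (g : Matrix (Fin m) (Fin m) ℂ) = exp X := by
  simpa using hX 1

/-- By the Lie product formula, `exp(t(X + Y))` is a limit of products of elements of `H`, and a
Zariski closed group is closed under limits in `GL_m(ℂ)`. -/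
theorem IsZariskiClosed.add_mem_lieAlg (hH : IsZariskiClosed H) {X Y : Matrix (Fin m) (Fin m) ℂ}
    (hX : X ∈ lieAlg H) (hY : Y ∈ lieAlg H) : X + Y ∈ lieAlg H := fun t => by
  choose x hx hx' using hX
  choose y hy hy' using hY
  obtain ⟨g, hg⟩ := Matrix.isUnit_exp (t • (X + Y))
  refine ⟨g, ?_, hg⟩
  refine hH.mem_of_tendsto (u := fun n : ℕ => (x ((n : ℂ)⁻¹ * t) * y ((n : ℂ)⁻¹ * t)) ^ n)
    (fun n => pow_mem (mul_mem (hx _) (hy _)) n) ?_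
  rw [hg, smul_add]
  refine (tendsto_exp_mul_exp_pow (t • X) (t • Y)).congr fun n => ?_
  rw [Units.val_pow_eq_pow_val, Units.val_mul, hx', hy', smul_smul, smul_smul]
  rfl

/-- The Lie algebra of a closed subgroup, as a linear subspace. -/
def lieSubmodule (hH : IsZariskiClosed H) : Submodule ℂ (Matrix (Fin m) (Fin m) ℂ) where
  carrier := lieAlg H
  add_mem' := hH.add_mem_lieAlg
  zero_mem' := fun t => ⟨1, one_mem H, by simp⟩
  smul_mem' := fun c X hX t => by
    obtain ⟨g, hg, h⟩ := hX (t * c)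
    exact ⟨g, hg, by rw [h, smul_smul]⟩

theorem conjGL_mem_lieAlg {g : GL (Fin m) ℂ} (hg : g ∈ H) {X : Matrix (Fin m) (Fin m) ℂ}
    (hX : X ∈ lieAlg H) : conjGL g X ∈ lieAlg H := fun t => by
  obtain ⟨x, hx, h⟩ := hX t
  exact ⟨g * x * g⁻¹, mul_mem (mul_mem hg hx) (inv_mem hg), by
    rw [exp_smul_conjGL, ← h, Units.val_mul, Units.val_mul]⟩

/-- If `exp(tX) Y exp(-tX)` stays in a linear subspace, then so does `[X, Y]`. -/
theorem bracket_mem_of_exp_conj_mem {V : Submodule ℂ (Matrix (Fin m) (Fin m) ℂ)}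
    {X Y : Matrix (Fin m) (Fin m) ℂ}
    (h : ∀ t : ℂ, exp (t • X) * Y * exp (-(t • X)) ∈ V) : X * Y - Y * X ∈ V := by
  have hd := Matrix.hasDerivAt_exp_conj X Y
  have hlim := hasDerivAt_iff_tendsto_slope.1 hd
  -- The difference quotients of the curve lie in `V`, which is closed, and they tend to the
  -- bracket.
  refine V.closed_of_finiteDimensional.mem_of_tendsto hlim (Eventually.of_forall fun t => ?_)
  rw [slope_def_module]
  exact V.smul_mem _ (V.sub_mem (h t) (h 0))

theorem bracket_mem_lieSubmodule (hH : IsZariskiClosed H) {X Y : Matrix (Fin m) (Fin m) ℂ}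
    (hX : X ∈ lieAlg H) (hY : Y ∈ lieAlg H) : X * Y - Y * X ∈ lieSubmodule hH := by
  refine bracket_mem_of_exp_conj_mem fun t => ?_
  obtain ⟨g, hg, h⟩ := hX t
  rw [← conjGL_of_coe_eq_exp h]
  exact conjGL_mem_lieAlg hg hY

end LieAlgebra

/-! ### The adjoint action of the L-group and its eigenspaces -/

section AdjointAction

open NormedSpace Filter Topology

attribute [local instance] Matrix.linftyOpNormedRing Matrix.linftyOpNormedAlgebra

variable {p : ℕ} [Fact p.Prime] {F : Type*} [Field F] [Algebra ℚ_[p] F]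
  [FiniteDimensional ℚ_[p] F] {m : ℕ} {Gd : Subgroup (GL (Fin m) ℂ)}
  {act : AbsGal F →* MulAut Gd}

/-- The automorphism of the dual group given by conjugation by an element of the L-group. -/
def innerL (x : LGroup p act) : Gd →* Gd :=
  (MulAut.conj x.left).toMonoidHom.comp (act (weilToGal p F x.right)).toMonoidHom

theorem conj_inl_eq (x : LGroup p act) (y : Gd) :
    x * SemidirectProduct.inl y * x⁻¹ = SemidirectProduct.inl (innerL x y) := by
  ext1
  · simp [innerL, mul_assoc]
  · simp

theorem innerL_mul (x y : LGroup p act) (g : Gd) : innerL (x * y) g = innerL x (innerL y g) := by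
  apply SemidirectProduct.inl_injective (φ := act.comp (weilToGal p F))
  rw [← conj_inl_eq, ← conj_inl_eq, ← conj_inl_eq]
  group

theorem innerL_inl (h g : Gd) :
    innerL (SemidirectProduct.inl h : LGroup p act) g = h * g * h⁻¹ := by
  apply SemidirectProduct.inl_injective (φ := act.comp (weilToGal p F))
  rw [← conj_inl_eq]
  simp

theorem exists_isDifferential_innerL
    (hreg : ∀ σ : AbsGal F, IsRegularMap (fun g : Gd => (g : GL (Fin m) ℂ))
      (fun g => (act σ g : GL (Fin m) ℂ))) (x : LGroup p act) :
    ∃ d, IsDifferential Gd.subtype (Gd.subtype.comp (innerL x)) d := by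
  obtain ⟨d, hd⟩ := IsRegularMap.exists_isDifferential (ι := Gd.subtype)
    (f := Gd.subtype.comp (act (weilToGal p F x.right)).toMonoidHom)
    (hreg (weilToGal p F x.right))
  refine ⟨(conjGL (x.left : GL (Fin m) ℂ)).comp d, fun X c hc t => ?_⟩
  rw [LinearMap.comp_apply, exp_smul_conjGL, ← hd X c hc]
  simp [innerL]

variable (hreg : ∀ σ : AbsGal F, IsRegularMap (fun g : Gd => (g : GL (Fin m) ℂ))
    (fun g => (act σ g : GL (Fin m) ℂ)))

/-- The adjoint action of the L-group on the Lie algebra of the dual group, extended to a linear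
map on the space of all matrices. -/
def AdL (x : LGroup p act) : Matrix (Fin m) (Fin m) ℂ →ₗ[ℂ] Matrix (Fin m) (Fin m) ℂ :=
  (exists_isDifferential_innerL hreg x).choose

/-- `AdL` is obtained by choice, and this property pins it down only on the Lie algebra of the dual
group; hence the membership hypotheses in the rules below. -/
theorem isDifferential_AdL (x : LGroup p act) :
    IsDifferential Gd.subtype (Gd.subtype.comp (innerL x)) (AdL hreg x) :=
  (exists_isDifferential_innerL hreg x).choose_spec

theorem innerL_oneParam (x : LGroup p act) {X : Matrix (Fin m) (Fin m) ℂ} (hX : X ∈ lieAlg Gd)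
    (t : ℂ) : (innerL x (oneParam ⟨X, hX⟩ t) : GL (Fin m) ℂ).val = exp (t • AdL hreg x X) :=
  isDifferential_AdL hreg x X (oneParam ⟨X, hX⟩) (oneParam_val ⟨X, hX⟩) t

theorem adL_eq (x : LGroup p act) {X : Matrix (Fin m) (Fin m) ℂ} (hX : X ∈ lieAlg Gd) :
    adL x ⟨X, hX⟩ = AdL hreg x X := by
  ext i j
  refine Eq.trans ?_ (Matrix.deriv_exp_smul_entry (AdL hreg x X) i j)
  change deriv _ 0 = _
  congr 1
  funext t
  rw [conj_inl_eq, ← innerL_oneParam hreg x hX]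
  rfl

/-- The adjoint action is determined by conjugation of the one-parameter subgroup. -/
theorem AdL_eq_of_conj {x : LGroup p act} {X Y : Matrix (Fin m) (Fin m) ℂ} {c b : ℂ → Gd}
    (hc : ∀ t, (c t : GL (Fin m) ℂ).val = exp (t • X))
    (hb : ∀ t, (b t : GL (Fin m) ℂ).val = exp (t • Y))
    (h : ∀ t, x * SemidirectProduct.inl (c t) * x⁻¹ = SemidirectProduct.inl (b t)) :
    AdL hreg x X = Y := by
  refine Matrix.eq_of_exp_smul_eq fun t => ?_
  rw [← isDifferential_AdL hreg x X c hc t, ← hb]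
  have := h t
  rw [conj_inl_eq] at this
  rw [← SemidirectProduct.inl_injective this]
  rfl

theorem AdL_mul (x y : LGroup p act) {X : Matrix (Fin m) (Fin m) ℂ} (hX : X ∈ lieAlg Gd) :
    AdL hreg (x * y) X = AdL hreg x (AdL hreg y X) := by
  refine Matrix.eq_of_exp_smul_eq fun t => ?_
  rw [← innerL_oneParam hreg (x * y) hX, innerL_mul,
    ← isDifferential_AdL hreg x _ (fun t => innerL y (oneParam ⟨X, hX⟩ t))
      (innerL_oneParam hreg y hX)]
  rfl

theorem AdL_one {X : Matrix (Fin m) (Fin m) ℂ} (hX : X ∈ lieAlg Gd) :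
    AdL hreg (1 : LGroup p act) X = X :=
  AdL_eq_of_conj hreg (oneParam_val ⟨X, hX⟩) (oneParam_val ⟨X, hX⟩) fun t => by simp

theorem AdL_inl (g : Gd) {X : Matrix (Fin m) (Fin m) ℂ} (hX : X ∈ lieAlg Gd) :
    AdL hreg (SemidirectProduct.inl g : LGroup p act) X = conjGL (g : GL (Fin m) ℂ) X := by
  refine Matrix.eq_of_exp_smul_eq fun t => ?_
  rw [← innerL_oneParam hreg _ hX, innerL_inl, exp_smul_conjGL, ← oneParam_val ⟨X, hX⟩]
  rfl

theorem AdL_bracket (x : LGroup p act) {X Y : Matrix (Fin m) (Fin m) ℂ} (hX : X ∈ lieAlg Gd)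
    (hY : Y ∈ lieAlg Gd) :
    AdL hreg x (X * Y - Y * X) = AdL hreg x X * AdL hreg x Y - AdL hreg x Y * AdL hreg x X :=
  (isDifferential_AdL hreg x).map_bracket (c := oneParam ⟨X, hX⟩) (b := oneParam ⟨Y, hY⟩)
    (oneParam_val ⟨X, hX⟩) (oneParam_val ⟨Y, hY⟩)

variable (hcl : IsZariskiClosed Gd)

/-- The elements of the Lie algebra of the dual group on which each `λ(w)` acts as the
scalar `χ(w)`. -/
def eigenspaceL {W : Type*} (lam : W → LGroup p act) (χ : W → ℂ) :
    Submodule ℂ (Matrix (Fin m) (Fin m) ℂ) where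
  carrier := {X | X ∈ lieAlg Gd ∧ ∀ w, AdL hreg (lam w) X = χ w • X}
  add_mem' := fun hX hY => ⟨hcl.add_mem_lieAlg hX.1 hY.1, fun w => by
    rw [map_add, hX.2, hY.2, smul_add]⟩
  zero_mem' := ⟨(lieSubmodule hcl).zero_mem, fun w => by simp⟩
  smul_mem' := fun c X hX => ⟨(lieSubmodule hcl).smul_mem c hX.1, fun w => by
    rw [map_smul, hX.2, smul_comm]⟩

theorem voganVariety_eq (lam : WeilGroup p F → LGroup p act) :
    voganVariety lam = eigenspaceL hreg hcl lam fun w => (weilNorm w : ℂ) := by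
  ext X
  refine ⟨fun ⟨hX, h⟩ => ⟨hX, fun w => ?_⟩, fun ⟨hX, h⟩ => ⟨hX, fun w => ?_⟩⟩
  · rw [← adL_eq hreg _ hX, h]
  · rw [adL_eq hreg _ hX, h]

/-- `g` commutes with every `λ(w)`, so `Ad(g)` preserves their joint eigenspaces. -/
theorem conjGL_mem_eigenspaceL {lam : WeilGroup p F → LGroup p act} {χ : WeilGroup p F → ℂ}
    {g : Gd} (hg : g ∈ centralizerOf lam) {X : Matrix (Fin m) (Fin m) ℂ}
    (hX : X ∈ eigenspaceL hreg hcl lam χ) :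
    conjGL (g : GL (Fin m) ℂ) X ∈ eigenspaceL hreg hcl lam χ := by
  refine ⟨conjGL_mem_lieAlg g.2 hX.1, fun w => ?_⟩
  have h1 : lam w * SemidirectProduct.inl g = SemidirectProduct.inl g * lam w :=
    (mul_inv_eq_iff_eq_mul.1 (hg w)).symm
  rw [← AdL_inl hreg (p := p) g hX.1, ← AdL_mul hreg _ _ hX.1, h1, AdL_mul hreg _ _ hX.1, hX.2,
    map_smul]

/-- Conjugation by `λ(w)` sends `exp X` to `exp (Ad(λ(w)) X) = exp X`. Thus the eigenspace of the
trivial character can play the role of the Lie algebra of `H_λ`. -/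
theorem mem_centralizerOf_of_exp {lam : WeilGroup p F → LGroup p act}
    {X : Matrix (Fin m) (Fin m) ℂ} (hX : X ∈ eigenspaceL hreg hcl lam fun _ => 1) {g : Gd}
    (hg : (g : GL (Fin m) ℂ).val = exp X) : g ∈ centralizerOf lam := fun w => by
  have h1 : innerL (lam w) g = g := by
    have h2 := innerL_oneParam hreg (lam w) hX.1 1
    have h3 : oneParam ⟨X, hX.1⟩ 1 = g := by
      apply Subtype.ext
      apply Units.ext
      rw [oneParam_val, hg, one_smul]
    rw [h3, hX.2, one_smul, one_smul, ← hg] at h2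
    exact Subtype.ext (Units.ext h2)
  have h4 := conj_inl_eq (lam w) g
  rw [h1, mul_inv_eq_iff_eq_mul] at h4
  rw [← h4, mul_inv_cancel_right]

end AdjointAction

/-! ### Local orbits of matrices, in a form free of any norm -/

section ExpConj

open NormedSpace Filter Topology

theorem Matrix.eventually_exists_exp_conj {m : ℕ} (h V : Submodule ℂ (Matrix (Fin m) (Fin m) ℂ))
    (Y : V) (hV : ∀ X ∈ h, exp X * (Y : Matrix (Fin m) (Fin m) ℂ) * exp (-X) ∈ V)
    (hsurj : ∀ Z ∈ V, ∃ X ∈ h, X * (Y : Matrix (Fin m) (Fin m) ℂ) - Y * X = Z) :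
    ∀ᶠ Z : V in 𝓝 Y, ∃ X ∈ h,
      (Z : Matrix (Fin m) (Fin m) ℂ) = exp X * (Y : Matrix (Fin m) (Fin m) ℂ) * exp (-X) := by
  let _ : NormedRing (Matrix (Fin m) (Fin m) ℂ) := Matrix.linftyOpNormedRing
  let _ : NormedAlgebra ℂ (Matrix (Fin m) (Fin m) ℂ) := Matrix.linftyOpNormedAlgebra
  exact _root_.eventually_exists_exp_conj h V Y hV hsurj

end ExpConj

/-! ### A Zariski openness criterion for orbits -/

section OpenOrbit

open NormedSpace Filter Topology

attribute [local instance] Matrix.linftyOpNormedRing Matrix.linftyOpNormedAlgebra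

variable {m : ℕ}

theorem exists_mvPolynomial_of_linear (l : Matrix (Fin m) (Fin m) ℂ →ₗ[ℂ] ℂ) :
    ∃ P : MvPolynomial (Fin m × Fin m) ℂ, ∀ X : Matrix (Fin m) (Fin m) ℂ,
      MvPolynomial.eval (fun ij : Fin m × Fin m => X ij.1 ij.2) P = l X := by
  refine ⟨∑ i, ∑ j, MvPolynomial.C (l (Matrix.single i j 1)) * MvPolynomial.X (i, j),
    fun X => ?_⟩
  conv_rhs => rw [Matrix.matrix_eq_sum_single X]
  simp only [map_sum, map_mul, MvPolynomial.eval_C, MvPolynomial.eval_X]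
  refine Finset.sum_congr rfl fun i _ => Finset.sum_congr rfl fun j _ => ?_
  rw [show Matrix.single i j (X i j) = X i j • Matrix.single i j (1 : ℂ) by
    rw [Matrix.smul_single, smul_eq_mul, mul_one], map_smul, smul_eq_mul, mul_comm]

/-- The set where a linear family of endomorphisms is invertible is Zariski open. -/
theorem exists_mvPolynomial_det {V : Type*} [AddCommGroup V] [Module ℂ V] [FiniteDimensional ℂ V]
    (T : Matrix (Fin m) (Fin m) ℂ →ₗ[ℂ] V →ₗ[ℂ] V) :
    ∃ P : MvPolynomial (Fin m × Fin m) ℂ, ∀ X : Matrix (Fin m) (Fin m) ℂ,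
      MvPolynomial.eval (fun ij : Fin m × Fin m => X ij.1 ij.2) P = LinearMap.det (T X) := by
  let b := Module.finBasis ℂ V
  choose P hP using fun k i => exists_mvPolynomial_of_linear
    (Matrix.entryLinearMap ℂ ℂ k i ∘ₗ (LinearMap.toMatrix b b).toLinearMap ∘ₗ T)
  refine ⟨(Matrix.of P).det, fun X => ?_⟩
  rw [RingHom.map_det, ← LinearMap.det_toMatrix b]
  congr 1
  ext k i
  simpa using hP k i X

/-- The set of zeros of a polynomial function on a complex line does not disconnect the line. -/
theorem isPreconnected_line_ne_zero (P : MvPolynomial (Fin m × Fin m) ℂ)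
    (Y Z : Matrix (Fin m) (Fin m) ℂ)
    (hY : MvPolynomial.eval (fun ij : Fin m × Fin m => Y ij.1 ij.2) P ≠ 0) :
    IsPreconnected {z : ℂ |
      MvPolynomial.eval (fun ij : Fin m × Fin m => (Y + z • Z) ij.1 ij.2) P ≠ 0} := by
  let q : Polynomial ℂ := MvPolynomial.aeval
    (fun ij : Fin m × Fin m => Polynomial.C (Y ij.1 ij.2) + Polynomial.X * Polynomial.C (Z ij.1 ij.2)) P
  have hq : ∀ z, q.eval z =
      MvPolynomial.eval (fun ij : Fin m × Fin m => (Y + z • Z) ij.1 ij.2) P := fun z => by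
    change Polynomial.evalRingHom z (MvPolynomial.aeval _ P) = _
    rw [MvPolynomial.aeval_def, MvPolynomial.hom_eval₂, MvPolynomial.eval, MvPolynomial.coe_eval₂Hom]
    congr 1
    · ext; simp
    · funext ij
      simp
      ring
  have hq0 : q ≠ 0 := fun h0 => hY (by simpa [h0] using (hq 0).symm)
  have hset : {z : ℂ | MvPolynomial.eval (fun ij : Fin m × Fin m => (Y + z • Z) ij.1 ij.2) P ≠ 0} =
      (q.roots.toFinset : Set ℂ)ᶜ := by
    ext z
    rw [Set.mem_ofPred_eq, ← hq]
    simp [hq0]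
  -- Since `ℂ` has real dimension `2`, removing a finite set of roots leaves it path connected.
  rw [hset]
  exact (q.roots.toFinset.finite_toSet.countable.isPathConnected_compl_of_one_lt_rank
    (by simp)).isConnected.isPreconnected

variable {V h : Submodule ℂ (Matrix (Fin m) (Fin m) ℂ)} {H : Subgroup (GL (Fin m) ℂ)}

/-- Let a group `H` of matrices act by conjugation on a linear space `V`, and let `h` be an
`H`-stable space of matrices with exponentials in `H`.  If `[h, Y₀] = V`, then the orbit of `Y₀` is
Zariski open in `V`. -/
theorem isZariskiOpenIn_orbit (hHV : ∀ g ∈ H, ∀ X ∈ V, conjGL g X ∈ V)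
    (hHh : ∀ g ∈ H, ∀ X ∈ h, conjGL g X ∈ h) (hexp : ∀ X ∈ h, ∃ g ∈ H, g.val = exp X)
    {Y₀ : Matrix (Fin m) (Fin m) ℂ} (hY₀ : Y₀ ∈ V)
    (hsurj : ∀ Z ∈ V, ∃ X ∈ h, X * Y₀ - Y₀ * X = Z) :
    IsZariskiOpenIn (V : Set (Matrix (Fin m) (Fin m) ℂ)) {Y | ∃ g ∈ H, Y = conjGL g Y₀} := by
  have hbr : ∀ X ∈ h, ∀ Y ∈ V, X * Y - Y * X ∈ V := fun X hX Y hY =>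
    bracket_mem_of_exp_conj_mem fun t => by
      obtain ⟨g, hg, hgX⟩ := hexp _ (h.smul_mem t hX)
      rw [← conjGL_of_coe_eq_exp hgX]
      exact hHV g hg Y hY
  obtain ⟨π, hπ⟩ := V.subtype.exists_leftInverse_of_injective V.ker_subtype
  replace hπ : ∀ v : V, π v = v := fun v => LinearMap.congr_fun hπ v
  -- near each point with surjective bracket there is a polynomial neighbourhood in one orbit
  have key : ∀ Y ∈ V, (∀ Z ∈ V, ∃ X ∈ h, X * Y - Y * X = Z) →
      ∃ P : MvPolynomial (Fin m × Fin m) ℂ,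
        MvPolynomial.eval (fun ij : Fin m × Fin m => Y ij.1 ij.2) P ≠ 0 ∧
        ∀ X ∈ V, MvPolynomial.eval (fun ij : Fin m × Fin m => X ij.1 ij.2) P ≠ 0 →
          ∃ g ∈ H, X = conjGL g Y := by
    intro Y hY hs
    let adY : h →ₗ[ℂ] V := (((LinearMap.mul ℂ _).flip Y - LinearMap.mul ℂ _ Y) ∘ₗ
      h.subtype).codRestrict V fun X => hbr X X.2 Y hY
    obtain ⟨σ, hσ⟩ := adY.exists_rightInverse_of_surjective (LinearMap.range_eq_top.2 fun Z => by
      obtain ⟨X, hX, hXZ⟩ := hs Z Z.2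
      exact ⟨⟨X, hX⟩, Subtype.ext hXZ⟩)
    -- With `σ` a linear section of `X ↦ [X, Y]`, the family `T X = π ∘ [σ(·), X]` is linear in `X`
    -- and equals the identity at `X = Y`. Where the polynomial `det (T X)` is nonzero, `[h, X]` is
    -- still all of `V`.
    let T : Matrix (Fin m) (Fin m) ℂ →ₗ[ℂ] V →ₗ[ℂ] V := LinearMap.mk₂ ℂ
      (fun X v => π ((σ v : Matrix (Fin m) (Fin m) ℂ) * X - X * σ v))
      (fun X X' v => by rw [← map_add]; congr 1; noncomm_ring)
      (fun c X v => by rw [← map_smul]; congr 1; simp [smul_sub])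
      (fun X v v' => by rw [← map_add]; congr 1; simp only [map_add, Submodule.coe_add]; noncomm_ring)
      (fun c X v => by rw [← map_smul]; congr 1; simp [smul_sub])
    obtain ⟨P, hP⟩ := exists_mvPolynomial_det T
    have hTY : T Y = LinearMap.id := LinearMap.ext fun v => by
      have h1 : ((σ v : Matrix (Fin m) (Fin m) ℂ) * Y - Y * σ v) = v :=
        congrArg Subtype.val (LinearMap.congr_fun hσ v)
      rw [LinearMap.mk₂_apply, h1, hπ, LinearMap.id_apply]
    have hPY : MvPolynomial.eval (fun ij : Fin m × Fin m => Y ij.1 ij.2) P ≠ 0 := by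
      rw [hP, hTY, LinearMap.det_id]; exact one_ne_zero
    refine ⟨P, hPY, fun X hX hPX => ?_⟩
    have hsur : ∀ X ∈ V, MvPolynomial.eval (fun ij : Fin m × Fin m => X ij.1 ij.2) P ≠ 0 →
        ∀ Z ∈ V, ∃ W ∈ h, W * X - X * W = Z := fun X hX hPX Z hZ => by
      rw [hP] at hPX
      obtain ⟨v, hv⟩ := (LinearMap.equivOfDetNeZero (T X) hPX).surjective ⟨Z, hZ⟩
      refine ⟨σ v, (σ v).2, ?_⟩
      have h1 := congrArg Subtype.val (hπ ⟨_, hbr _ (σ v).2 X hX⟩)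
      exact h1.symm.trans (congrArg Subtype.val hv)
    -- On the line from `Y` to `X`, minus the zeros of `P`, each point has a neighbourhood inside
    -- its own orbit. This set is connected, so lying in the same orbit, being a locally constant
    -- relation, holds between its points `z = 0` and `z = 1`.
    let γ : ℂ → V := fun z => ⟨Y + z • (X - Y), V.add_mem hY (V.smul_mem z (V.sub_mem hX hY))⟩
    have hγ : Continuous γ := by
      refine Continuous.subtype_mk ?_ _
      fun_prop
    have hconn := isPreconnected_line_ne_zero P Y (X - Y) hPY
    have h01 := hconn.induction₂ (fun z z' => ∃ g ∈ H, (γ z' : Matrix (Fin m) (Fin m) ℂ) =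
      conjGL g (γ z)) (fun z hz => ?_) ?_ ?_ (x := 0) (y := 1) (by simpa using hPY)
      (by simpa using hPX)
    · simpa [γ] using h01
    · have hex := Matrix.eventually_exists_exp_conj h V (γ z) (fun W hW => ?_) (hsur _ (γ z).2 hz)
      · filter_upwards [((hγ.tendsto z).mono_left nhdsWithin_le_nhds).eventually hex]
        rintro z' ⟨W, hW, hZ⟩
        obtain ⟨g, hg, hgW⟩ := hexp W hW
        exact ⟨g, hg, by rw [hZ, conjGL_of_coe_eq_exp hgW]⟩
      · obtain ⟨g, hg, hgW⟩ := hexp W hW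
        rw [← conjGL_of_coe_eq_exp hgW]
        exact hHV g hg _ (γ z).2
    · rintro x y z - - - ⟨g, hg, hxy⟩ ⟨g', hg', hyz⟩
      exact ⟨g' * g, mul_mem hg' hg, by rw [hyz, hxy, conjGL_mul]⟩
    · rintro x y - - ⟨g, hg, hxy⟩
      exact ⟨g⁻¹, inv_mem hg, by rw [hxy, ← conjGL_mul, inv_mul_cancel]; simp [conjGL_apply]⟩
  -- The largest possible family: all polynomials whose non-vanishing locus in `V` is contained in
  -- the orbit of `Y₀`.
  refine ⟨{P | ∀ X ∈ V, MvPolynomial.eval (fun ij : Fin m × Fin m => X ij.1 ij.2) P ≠ 0 →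
    ∃ g ∈ H, X = conjGL g Y₀}, Set.ext fun Y => ⟨?_, ?_⟩⟩
  · rintro ⟨g, hg, rfl⟩
    have hV := hHV g hg Y₀ hY₀
    have hinv : ∀ X, conjGL g (conjGL g⁻¹ X) = X := fun X => by
      rw [← conjGL_mul, mul_inv_cancel]; simp [conjGL_apply]
    -- Conjugation by `g` carries the surjectivity of the bracket from `Y₀` to every point of its
    -- orbit, as `h` and `V` are stable.
    obtain ⟨P, hP1, hP2⟩ := key _ hV fun Z hZ => by
      obtain ⟨X, hX, hXZ⟩ := hsurj _ (hHV g⁻¹ (inv_mem hg) Z hZ)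
      refine ⟨conjGL g X, hHh g hg X hX, ?_⟩
      rw [← hinv Z, ← hXZ, conjGL_bracket]
    refine ⟨hV, P, fun X hX hPX => ?_, hP1⟩
    obtain ⟨g', hg', hX'⟩ := hP2 X hX hPX
    exact ⟨g' * g, mul_mem hg' hg, by rw [hX', conjGL_mul]⟩
  · rintro ⟨hY, P, hP, hPY⟩
    exact hP Y hY hPY

end OpenOrbit

/-! ### Weight decompositions of representations of `ℂˣ` -/

section Weights

/-- The homomorphism `z ↦ diag(z, z⁻¹)`. -/
def diagHom : ℂˣ →* SL(2, ℂ) where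
  toFun := diagSL
  map_one' := by ext i j; fin_cases i <;> fin_cases j <;> simp [diagSL]
  map_mul' y z := Subtype.ext <| by
    change _ = !![(y : ℂ), 0; 0, ((y⁻¹ : ℂˣ) : ℂ)] * !![(z : ℂ), 0; 0, ((z⁻¹ : ℂˣ) : ℂ)]
    simp [diagSL, mul_comm]

theorem diagHom_apply (z : ℂˣ) : diagHom z = diagSL z := rfl

theorem glCoords_diagSL (z : ℂˣ) : glCoords (diagSL z : GL (Fin 2) ℂ) =
    Sum.elim (fun ij => !![(z : ℂ), 0; 0, ((z⁻¹ : ℂˣ) : ℂ)] ij.1 ij.2)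
      (fun ij => !![((z⁻¹ : ℂˣ) : ℂ), 0; 0, (z : ℂ)] ij.1 ij.2) := by
  have hinv : ((diagSL z : GL (Fin 2) ℂ)⁻¹) = (diagSL z⁻¹ : GL (Fin 2) ℂ) := by
    rw [← diagHom_apply, ← diagHom_apply, map_inv, map_inv]
  funext x
  rcases x with ⟨i, j⟩ | ⟨i, j⟩
  · rfl
  · rw [glCoords, hinv, Sum.elim_inr, Sum.elim_inr]
    conv_rhs => rw [← inv_inv z]
    rfl

/-- A family of matrices depending polynomially on the points of the torus `diag(z, z⁻¹)` is a
Laurent polynomial in `z`. -/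
theorem exists_laurent_expansion (Q : MvPolynomial ((Fin 2 × Fin 2) ⊕ (Fin 2 × Fin 2)) ℂ) :
    ∃ c : ℤ →₀ ℂ, ∀ z : ℂˣ,
      MvPolynomial.eval (glCoords (diagSL z : GL (Fin 2) ℂ)) Q =
        c.sum fun k a => a * ((z ^ k : ℂˣ) : ℂ) := by
  have hadd : ∀ (c c' : ℤ →₀ ℂ) (z : ℂˣ), ((c + c').sum fun k a => a * ((z ^ k : ℂˣ) : ℂ)) =
      (c.sum fun k a => a * ((z ^ k : ℂˣ) : ℂ)) + c'.sum fun k a => a * ((z ^ k : ℂˣ) : ℂ) :=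
    fun c c' z => Finsupp.sum_add_index' (by simp) (by intros; ring)
  have hshift : ∀ (c : ℤ →₀ ℂ) (l : ℤ) (z : ℂˣ),
      ((c.mapDomain (· + l)).sum fun k a => a * ((z ^ k : ℂˣ) : ℂ)) =
        (c.sum fun k a => a * ((z ^ k : ℂˣ) : ℂ)) * ((z ^ l : ℂˣ) : ℂ) := fun c l z => by
    rw [Finsupp.sum_mapDomain_index (by simp) (by intros; ring), Finsupp.sum_mul]
    refine Finsupp.sum_congr fun k _ => ?_
    rw [_root_.zpow_add, Units.val_mul, mul_assoc]
  induction Q using MvPolynomial.induction_on with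
  | C r => exact ⟨Finsupp.single 0 r, fun z => by simp⟩
  | add P Q hP hQ =>
    obtain ⟨c, hc⟩ := hP
    obtain ⟨c', hc'⟩ := hQ
    exact ⟨c + c', fun z => by rw [map_add, hc, hc', hadd]⟩
  | mul_X P i hP =>
    obtain ⟨c, hc⟩ := hP
    -- Each coordinate of `diag(z, z⁻¹)` and of its inverse is `z`, `z⁻¹` or `0`, so multiplying by
    -- it shifts the exponents or gives zero.
    have hi : (∃ l : ℤ, ∀ z : ℂˣ, glCoords (diagSL z : GL (Fin 2) ℂ) i = ((z ^ l : ℂˣ) : ℂ)) ∨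
        ∀ z : ℂˣ, glCoords (diagSL z : GL (Fin 2) ℂ) i = 0 := by
      simp only [glCoords_diagSL]
      rcases i with ⟨i, j⟩ | ⟨i, j⟩ <;> fin_cases i <;> fin_cases j
      · exact Or.inl ⟨1, fun z => by simp⟩
      · exact Or.inr fun z => by simp
      · exact Or.inr fun z => by simp
      · exact Or.inl ⟨-1, fun z => by simp⟩
      · exact Or.inl ⟨-1, fun z => by simp⟩
      · exact Or.inr fun z => by simp
      · exact Or.inr fun z => by simp
      · exact Or.inl ⟨1, fun z => by simp⟩
    rcases hi with ⟨l, hl⟩ | h0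
    · exact ⟨c.mapDomain (· + l), fun z => by
        rw [map_mul, MvPolynomial.eval_X, hl, hc, hshift]⟩
    · exact ⟨0, fun z => by simp [h0]⟩

variable {m : ℕ}

/-- Dedekind's independence of characters, entry by entry. The characters `z ↦ z ^ k` are distinct
because they already differ at `z = 2`. -/
theorem eq_of_sum_zpow_smul_eq {S : Finset ℤ} {A B : ℤ → Matrix (Fin m) (Fin m) ℂ}
    (h : ∀ z : ℂˣ, ∑ k ∈ S, ((z ^ k : ℂˣ) : ℂ) • A k = ∑ k ∈ S, ((z ^ k : ℂˣ) : ℂ) • B k) :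
    ∀ k ∈ S, A k = B k := by
  let χ : ℤ → ℂˣ →* ℂ := fun k => (Units.coeHom ℂ).comp (zpowGroupHom k)
  have hχ : Function.Injective χ := fun k l hkl => by
    have h2 := DFunLike.congr_fun hkl (Units.mk0 (2 : ℂ) two_ne_zero)
    simp only [χ, MonoidHom.comp_apply, Units.coeHom_apply, zpowGroupHom_apply,
      Units.val_zpow_eq_zpow_val, Units.val_mk0] at h2
    have h3 : (2 : ℝ) ^ k = 2 ^ l := by simpa using congrArg norm h2
    exact zpow_right_injective₀ (by norm_num) (by norm_num) h3
  have hli := (linearIndependent_monoidHom ℂˣ ℂ).comp χ hχ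
  intro k hk
  ext i j
  have hz : ∑ k ∈ S, (A k i j - B k i j) • ((fun f : ℂˣ →* ℂ => (f : ℂˣ → ℂ)) ∘ χ) k = 0 := by
    funext z
    have := congrFun (congrFun (h z) i) j
    simp only [Matrix.sum_apply, Matrix.smul_apply, smul_eq_mul] at this
    simp only [Finset.sum_apply, Pi.smul_apply, Function.comp_apply, smul_eq_mul, Pi.zero_apply,
      sub_mul, Finset.sum_sub_distrib, sub_eq_zero]
    simpa [χ, mul_comm] using this
  exact sub_eq_zero.1 (linearIndependent_iff'.1 hli S _ hz k hk)

/-- The decomposition of a representation of `ℂˣ` into weight spaces, with projections `P k`. -/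
structure IsWeightDecomposition (ρ : ℂˣ →* GL (Fin m) ℂ) (S : Finset ℤ)
    (P : ℤ → Matrix (Fin m) (Fin m) ℂ) : Prop where
  coe_eq : ∀ z, (ρ z).val = ∑ k ∈ S, ((z ^ k : ℂˣ) : ℂ) • P k
  mul_coe : ∀ k ∈ S, ∀ z, P k * (ρ z).val = ((z ^ k : ℂˣ) : ℂ) • P k
  coe_mul : ∀ k ∈ S, ∀ z, (ρ z).val * P k = ((z ^ k : ℂˣ) : ℂ) • P k
  mul_self : ∀ k ∈ S, P k * P k = P k
  mul_eq_zero : ∀ k ∈ S, ∀ l ∈ S, k ≠ l → P k * P l = 0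

/-- Comparing coefficients of the characters in `ρ(zy) = ρ(z) ρ(y)` gives the weights of the `P k`;
comparing once more in `P k * ρ(z)` gives their orthogonality. -/
theorem isWeightDecomposition_of_coe_eq {ρ : ℂˣ →* GL (Fin m) ℂ} {S : Finset ℤ}
    {P : ℤ → Matrix (Fin m) (Fin m) ℂ}
    (h : ∀ z, (ρ z).val = ∑ k ∈ S, ((z ^ k : ℂˣ) : ℂ) • P k) : IsWeightDecomposition ρ S P := by
  have h1 : ∀ y, ∀ k ∈ S, P k * (ρ y).val = ((y ^ k : ℂˣ) : ℂ) • P k := fun y =>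
    eq_of_sum_zpow_smul_eq fun z => by
      have h2 := h (z * y)
      rw [map_mul, Units.val_mul, h z, Finset.sum_mul] at h2
      simp only [smul_mul_assoc] at h2
      rw [h2]
      refine Finset.sum_congr rfl fun k _ => ?_
      rw [smul_smul, mul_zpow, Units.val_mul]
  have h2 : ∀ y, ∀ k ∈ S, (ρ y).val * P k = ((y ^ k : ℂˣ) : ℂ) • P k := fun y =>
    eq_of_sum_zpow_smul_eq fun z => by
      have h2 := h (y * z)
      rw [map_mul, Units.val_mul, h z, Finset.mul_sum] at h2
      simp only [mul_smul_comm] at h2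
      rw [h2]
      refine Finset.sum_congr rfl fun k _ => ?_
      rw [smul_smul, mul_comm y z, mul_zpow, Units.val_mul]
  have h3 : ∀ k ∈ S, ∀ l ∈ S, P k * P l = if k = l then P k else 0 := fun k hk =>
    eq_of_sum_zpow_smul_eq fun z => by
      have h4 := h1 z k hk
      rw [h z, Finset.mul_sum] at h4
      simp only [mul_smul_comm] at h4
      rw [h4, Finset.sum_eq_single_of_mem k hk (fun l _ hl => by rw [if_neg (Ne.symm hl), smul_zero]),
        if_pos rfl]
  exact ⟨h, fun k hk z => h1 z k hk, fun k hk z => h2 z k hk,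
    fun k hk => by rw [h3 k hk k hk, if_pos rfl],
    fun k hk l hl hkl => by rw [h3 k hk l hl, if_neg hkl]⟩

namespace IsWeightDecomposition

variable {ρ : ℂˣ →* GL (Fin m) ℂ} {S : Finset ℤ} {P : ℤ → Matrix (Fin m) (Fin m) ℂ}

theorem sum_eq_one (hP : IsWeightDecomposition ρ S P) : ∑ k ∈ S, P k = 1 := by
  simpa using (hP.coe_eq 1).symm

/-- `tr h² = ∑ k² rank (P k)` is a sum of non-negative integers, so its vanishing kills every `P k`
with `k ≠ 0`. -/
theorem eq_one_of_trace_eq_zero (hP : IsWeightDecomposition ρ S P)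
    {h : Matrix (Fin m) (Fin m) ℂ} (hh : h = ∑ k ∈ S, (k : ℂ) • P k) (ht : (h * h).trace = 0)
    (z : ℂˣ) : ρ z = 1 := by
  have hh2 : h * h = ∑ k ∈ S, ((k : ℂ) ^ 2) • P k := by
    conv_lhs => rw [hh]
    rw [Finset.sum_mul_sum]
    refine Finset.sum_congr rfl fun k hk => ?_
    rw [Finset.sum_eq_single_of_mem k hk fun l hl hkl => by
      rw [smul_mul_smul_comm, hP.mul_eq_zero k hk l hl hkl.symm, smul_zero]]
    rw [smul_mul_smul_comm, hP.mul_self k hk, sq]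
  have htr : ∀ k ∈ S, ∃ d : ℕ, (P k).trace = d ∧ (d = 0 → P k = 0) := fun k hk => by
    have hid : IsIdempotentElem (Matrix.toLin' (P k)) := by
      rw [IsIdempotentElem, Module.End.mul_eq_comp, ← Matrix.toLin'_mul, hP.mul_self k hk]
    have h1 := (LinearMap.IsIdempotentElem.isProj_range _ hid).trace
    rw [Matrix.trace_toLin'_eq] at h1
    refine ⟨_, h1, fun h0 => ?_⟩
    rw [h0, Nat.cast_zero, ← Matrix.trace_toLin'_eq] at h1
    exact Matrix.toLin'.map_eq_zero_iff.1 (LinearMap.IsIdempotentElem.eq_zero_of_trace_eq_zero hid h1)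
  choose! d hd hd0 using htr
  have hsum : ∑ k ∈ S, k ^ 2 * (d k : ℤ) = 0 := by
    have : ((∑ k ∈ S, k ^ 2 * (d k : ℤ) : ℤ) : ℂ) = 0 := by
      rw [← ht, hh2, Matrix.trace_sum]
      push_cast
      refine Finset.sum_congr rfl fun k hk => ?_
      rw [Matrix.trace_smul, hd k hk, smul_eq_mul]
    exact_mod_cast this
  rw [Finset.sum_eq_zero_iff_of_nonneg fun k _ => by positivity] at hsum
  refine Units.ext ?_
  rw [hP.coe_eq, Units.val_one, ← hP.sum_eq_one]
  refine Finset.sum_congr rfl fun k hk => ?_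
  rcases _root_.mul_eq_zero.1 (hsum k hk) with h0 | h0
  · rw [pow_eq_zero_iff two_ne_zero] at h0
    rw [h0, zpow_zero, Units.val_one, one_smul]
  · rw [hd0 k hk (by exact_mod_cast h0), smul_zero]

/-- If `r ^ (-d j) ρ(r ^ j) X ρ(r ^ j)⁻¹` is bounded for all integers `j`, then `X` has weight
`d`. -/
theorem conj_eq_of_bounded (hP : IsWeightDecomposition ρ S P) {X : Matrix (Fin m) (Fin m) ℂ}
    {r : ℂˣ} (hr : ‖(r : ℂ)‖ ≠ 1) (d : ℤ)
    (hb : ∃ C : ℝ, ∀ (j : ℤ) (a b : Fin m),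
      ‖((((r ^ j) ^ (-d) : ℂˣ) : ℂ) • conjGL (ρ (r ^ j)) X) a b‖ ≤ C) (z : ℂˣ) :
    conjGL (ρ z) X = ((z ^ d : ℂˣ) : ℂ) • X := by
  -- The block `P k * X * P l` has weight `k - l` under conjugation.
  have hconj : ∀ k ∈ S, ∀ l ∈ S, ∀ y,
      P k * conjGL (ρ y) X * P l = ((y ^ (k - l) : ℂˣ) : ℂ) • (P k * X * P l) :=
    fun k hk l hl y => by
      rw [conjGL_apply, ← map_inv]
      calc P k * ((ρ y).val * X * (ρ y⁻¹).val) * P l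
          = (P k * (ρ y).val) * X * ((ρ y⁻¹).val * P l) := by simp only [mul_assoc]
        _ = _ := by
          rw [hP.mul_coe k hk, hP.coe_mul l hl, smul_mul_assoc, smul_mul_assoc, mul_smul_comm,
            smul_smul, _root_.zpow_sub, _root_.inv_zpow, Units.val_mul]
  obtain ⟨C, hC⟩ := hb
  have hzero : ∀ k ∈ S, ∀ l ∈ S, k - l ≠ d → P k * X * P l = 0 := fun k hk l hl hkl => by
    ext a b
    by_contra hne
    rw [Matrix.zero_apply] at hne
    have hbd : ∀ j : ℤ, (‖(r : ℂ)‖ ^ (k - l - d)) ^ j * ‖(P k * X * P l) a b‖ ≤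
        ∑ x, (∑ y, ‖P k a y‖ * C) * ‖P l x b‖ := fun j => by
      have h1 : P k * ((((r ^ j) ^ (-d) : ℂˣ) : ℂ) • conjGL (ρ (r ^ j)) X) * P l =
          (((r ^ (k - l - d)) ^ j : ℂˣ) : ℂ) • (P k * X * P l) := by
        rw [mul_smul_comm, smul_mul_assoc, hconj k hk l hl, smul_smul, ← Units.val_mul,
          ← _root_.zpow_add, ← _root_.zpow_mul, ← _root_.zpow_mul]
        congr 3
        ring_nf
      have hC' := hC j
      generalize (((r ^ j) ^ (-d) : ℂˣ) : ℂ) • conjGL (ρ (r ^ j)) X = Y at h1 hC'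
      have h2 : ‖(((r ^ (k - l - d)) ^ j : ℂˣ) : ℂ)‖ = (‖(r : ℂ)‖ ^ (k - l - d)) ^ j := by simp
      rw [← h2, ← norm_smul, ← Matrix.smul_apply, ← h1, Matrix.mul_apply]
      refine (norm_sum_le _ _).trans (Finset.sum_le_sum fun x _ => ?_)
      rw [norm_mul]
      gcongr
      rw [Matrix.mul_apply]
      refine (norm_sum_le _ _).trans (Finset.sum_le_sum fun y _ => ?_)
      rw [norm_mul]
      gcongr
      exact hC' y x
    set M := ∑ x, (∑ y, ‖P k a y‖ * C) * ‖P l x b‖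
    have hpos : 0 < ‖(P k * X * P l) a b‖ := norm_pos_iff.2 hne
    have hr0 : 0 < ‖(r : ℂ)‖ := norm_pos_iff.2 r.ne_zero
    set s := ‖(r : ℂ)‖ ^ (k - l - d)
    have hs0 : 0 < s := zpow_pos hr0 _
    have hs1 : s ≠ 1 := fun h1 => by
      rw [zpow_eq_one_iff_right₀ hr0.le hr] at h1
      exact hkl (by omega)
    -- A block with `k - l ≠ d` is scaled by powers of `s ≠ 1`. If `s > 1` it blows up as `j → ∞`,
    -- if `s < 1` as `j → -∞`; this is why the bound is required for negative `j` too.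
    have hs : ∃ t : ℝ, 1 < t ∧ ∀ n : ℕ, t ^ n * ‖(P k * X * P l) a b‖ ≤ M := by
      rcases lt_or_gt_of_ne hs1 with h | h
      · exact ⟨s⁻¹, (one_lt_inv₀ hs0).2 h, fun n => by simpa using hbd (-n)⟩
      · exact ⟨s, h, fun n => by simpa using hbd n⟩
    obtain ⟨t, ht1, ht⟩ := hs
    obtain ⟨n, hn⟩ := pow_unbounded_of_one_lt (M / ‖(P k * X * P l) a b‖) ht1
    rw [div_lt_iff₀ hpos] at hn
    exact absurd (ht n) (not_le.2 hn)
  have hexp : ∀ Y : Matrix (Fin m) (Fin m) ℂ, Y = ∑ k ∈ S, ∑ l ∈ S, P k * Y * P l := fun Y => by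
    calc Y = (∑ k ∈ S, P k) * Y * ∑ l ∈ S, P l := by rw [hP.sum_eq_one, one_mul, mul_one]
      _ = _ := by
        simp only [Finset.sum_mul, Finset.mul_sum]
        exact Finset.sum_comm
  rw [hexp (conjGL (ρ z) X)]
  conv_rhs => rw [hexp X]
  rw [Finset.smul_sum]
  refine Finset.sum_congr rfl fun k hk => ?_
  rw [Finset.smul_sum]
  refine Finset.sum_congr rfl fun l hl => ?_
  rw [hconj k hk l hl]
  by_cases hkl : k - l = d
  · rw [hkl]
  · rw [hzero k hk l hl hkl, smul_zero, smul_zero]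

end IsWeightDecomposition

end Weights

/-! ### Triples attached to representations of `SL₂`, and trace arguments -/

section SL2

open NormedSpace Filter Topology

attribute [local instance] Matrix.linftyOpNormedRing Matrix.linftyOpNormedAlgebra

theorem coe_upperU (t : ℂ) :
    ((upperU t : GL (Fin 2) ℂ)).val = exp (t • !![(0 : ℂ), 1; 0, 0]) := by
  refine oneParam_eq_exp_of_hasDerivAt (f := fun t : ℂ => !![(1 : ℂ), t; 0, 1])
    (fun s t => ?_) Matrix.one_fin_two.symm ?_ t
  · simp [add_comm]
  · refine Matrix.hasDerivAt_iff_entries.2 fun i j => ?_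
    fin_cases i <;> fin_cases j
    · exact hasDerivAt_const _ _
    · exact hasDerivAt_id _
    · exact hasDerivAt_const _ _
    · exact hasDerivAt_const _ _

theorem coe_lowerU (t : ℂ) :
    ((lowerU t : GL (Fin 2) ℂ)).val = exp (t • !![(0 : ℂ), 0; 1, 0]) := by
  refine oneParam_eq_exp_of_hasDerivAt (f := fun t : ℂ => !![(1 : ℂ), 0; t, 1])
    (fun s t => ?_) Matrix.one_fin_two.symm ?_ t
  · simp
  · refine Matrix.hasDerivAt_iff_entries.2 fun i j => ?_
    fin_cases i <;> fin_cases j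
    · exact hasDerivAt_const _ _
    · exact hasDerivAt_const _ _
    · exact hasDerivAt_id _
    · exact hasDerivAt_const _ _

/-- The unit `e ^ t`. -/
def expUnit (t : ℂ) : ℂˣ := Units.mk0 (Complex.exp t) (Complex.exp_ne_zero t)

theorem coe_diagSL_expUnit (t : ℂ) :
    ((diagSL (expUnit t) : GL (Fin 2) ℂ)).val = exp (t • !![(1 : ℂ), 0; 0, -1]) := by
  refine oneParam_eq_exp_of_hasDerivAt
    (f := fun t : ℂ => !![Complex.exp t, 0; 0, (Complex.exp t)⁻¹]) (fun s t => ?_) ?_ ?_ t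
  · simp [Complex.exp_add, mul_comm]
  · simp [Matrix.one_fin_two]
  · refine Matrix.hasDerivAt_iff_entries.2 fun i j => ?_
    fin_cases i <;> fin_cases j
    · simpa using Complex.hasDerivAt_exp 0
    · exact hasDerivAt_const _ _
    · exact hasDerivAt_const _ _
    · have h := (Complex.hasDerivAt_exp 0).fun_inv (Complex.exp_ne_zero 0)
      simpa using! h

variable {m : ℕ}

/-- `(e, h, f)` is the `sl₂`-triple of the representation `ρ` of `SL₂(ℂ)`. -/
structure IsTripleOf (ρ : SL(2, ℂ) →* GL (Fin m) ℂ) (e h f : Matrix (Fin m) (Fin m) ℂ) :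
    Prop where
  upper : ∀ t, (ρ (upperU t)).val = exp (t • e)
  lower : ∀ t, (ρ (lowerU t)).val = exp (t • f)
  diag : ∀ t, (ρ (diagSL (expUnit t))).val = exp (t • h)
  h_e : h * e - e * h = (2 : ℂ) • e
  h_f : h * f - f * h = (-2 : ℂ) • f
  e_f : e * f - f * e = h

/-- The images of the standard basis of `sl₂` under the differential of `ρ`, which respects
brackets. -/
theorem exists_isTripleOf {ρ : SL(2, ℂ) →* GL (Fin m) ℂ}
    (hρ : IsRegularMap (fun x : SL(2, ℂ) => (x : GL (Fin 2) ℂ)) ρ) :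
    ∃ e h f, IsTripleOf ρ e h f := by
  obtain ⟨d, hd⟩ := IsRegularMap.exists_isDifferential (ι := SpecialLinearGroup.toGL) (f := ρ) hρ
  have he := coe_upperU
  have hf := coe_lowerU
  have hh := coe_diagSL_expUnit
  refine ⟨_, _, _, hd _ _ he, hd _ _ hf, hd _ _ hh, ?_, ?_, ?_⟩
  · rw [← hd.map_bracket (c := fun t => diagSL (expUnit t)) (b := upperU) hh he, ← map_smul]
    congr 1
    ext i j
    fin_cases i <;> fin_cases j <;> norm_num
  · rw [← hd.map_bracket (c := fun t => diagSL (expUnit t)) (b := lowerU) hh hf, ← map_smul]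
    congr 1
    ext i j
    fin_cases i <;> fin_cases j <;> norm_num
  · rw [← hd.map_bracket (c := upperU) (b := lowerU) he hf]
    congr 1
    ext i j
    fin_cases i <;> fin_cases j <;> norm_num

theorem diagSL_conj_upperU (z : ℂˣ) (t : ℂ) :
    diagSL z * upperU t * (diagSL z)⁻¹ = upperU ((z : ℂ) ^ 2 * t) := by
  rw [mul_inv_eq_iff_eq_mul]
  refine Subtype.ext ?_
  change !![(z : ℂ), 0; 0, ((z⁻¹ : ℂˣ) : ℂ)] * !![1, t; 0, 1] =
    !![1, (z : ℂ) ^ 2 * t; 0, 1] * !![(z : ℂ), 0; 0, ((z⁻¹ : ℂˣ) : ℂ)]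
  have := z.ne_zero
  ext i j
  fin_cases i <;> fin_cases j <;> simp
  field_simp

theorem diagSL_conj_lowerU (z : ℂˣ) (t : ℂ) :
    diagSL z * lowerU t * (diagSL z)⁻¹ = lowerU (((z⁻¹ : ℂˣ) : ℂ) ^ 2 * t) := by
  rw [mul_inv_eq_iff_eq_mul]
  refine Subtype.ext ?_
  change !![(z : ℂ), 0; 0, ((z⁻¹ : ℂˣ) : ℂ)] * !![1, 0; t, 1] =
    !![1, 0; ((z⁻¹ : ℂˣ) : ℂ) ^ 2 * t, 1] * !![(z : ℂ), 0; 0, ((z⁻¹ : ℂˣ) : ℂ)]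
  have := z.ne_zero
  ext i j
  fin_cases i <;> fin_cases j <;> simp
  field_simp

namespace IsTripleOf

variable {ρ : SL(2, ℂ) →* GL (Fin m) ℂ} {e h f : Matrix (Fin m) (Fin m) ℂ}

theorem conj_e (hT : IsTripleOf ρ e h f) (z : ℂˣ) :
    conjGL (ρ (diagSL z)) e = ((z : ℂ) ^ 2) • e := by
  refine Matrix.eq_of_exp_smul_eq fun t => ?_
  rw [exp_smul_conjGL, ← hT.upper, smul_smul, mul_comm, ← hT.upper, ← diagSL_conj_upperU]
  simp

theorem conj_f (hT : IsTripleOf ρ e h f) (z : ℂˣ) :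
    conjGL (ρ (diagSL z)) f = (((z⁻¹ : ℂˣ) : ℂ) ^ 2) • f := by
  refine Matrix.eq_of_exp_smul_eq fun t => ?_
  rw [exp_smul_conjGL, ← hT.lower, smul_smul, mul_comm, ← hT.lower, ← diagSL_conj_lowerU]
  simp

/-- The infinitesimal form of a weight. -/
theorem bracket_h_of_conj (hT : IsTripleOf ρ e h f) {X : Matrix (Fin m) (Fin m) ℂ} {d : ℤ}
    (hX : ∀ z : ℂˣ, conjGL (ρ (diagSL z)) X = ((z ^ d : ℂˣ) : ℂ) • X) :
    h * X - X * h = (d : ℂ) • X := by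
  have h1 := Matrix.hasDerivAt_exp_conj h X
  have h2 : HasDerivAt (fun t : ℂ => Complex.exp (d * t)) (d : ℂ) 0 := by
    simpa using ((hasDerivAt_id (0 : ℂ)).const_mul (d : ℂ)).cexp
  refine h1.unique ((h2.smul_const X).congr_of_eventuallyEq (Eventually.of_forall fun t => ?_))
  change exp (t • h) * X * exp (-(t • h)) = Complex.exp (d * t) • X
  rw [← conjGL_of_coe_eq_exp (hT.diag t), hX, Complex.exp_int_mul]
  simp [expUnit]

/-- The matrix entries of `ρ` on the torus are Laurent polynomials in `z`; the coefficient matrices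
are the projections. -/
theorem exists_isWeightDecomposition
    (hρ : IsRegularMap (fun x : SL(2, ℂ) => (x : GL (Fin 2) ℂ)) ρ) :
    ∃ S P, IsWeightDecomposition (ρ.comp diagHom) S P := by
  choose Q hQ using hρ
  choose c hc using fun i j => exists_laurent_expansion (Q i j)
  refine ⟨Finset.univ.biUnion fun i => Finset.univ.biUnion fun j => (c i j).support,
    fun k => Matrix.of fun i j => c i j k, isWeightDecomposition_of_coe_eq fun z => ?_⟩
  ext i j
  rw [Matrix.sum_apply]
  refine (hQ i j (diagSL z)).trans ((hc i j z).trans ?_)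
  rw [Finsupp.sum_of_support_subset (s := Finset.univ.biUnion fun i => Finset.univ.biUnion fun j =>
    (c i j).support) _ (fun k hk => ?_) _ (by simp)]
  · refine Finset.sum_congr rfl fun k _ => ?_
    rw [Matrix.smul_apply, Matrix.of_apply, smul_eq_mul, mul_comm]
  · simp only [Finset.mem_biUnion, Finset.mem_univ, true_and]
    exact ⟨i, j, hk⟩

theorem h_eq_sum (hT : IsTripleOf ρ e h f) {S : Finset ℤ} {P : ℤ → Matrix (Fin m) (Fin m) ℂ}
    (hP : IsWeightDecomposition (ρ.comp diagHom) S P) : h = ∑ k ∈ S, (k : ℂ) • P k := by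
  have h1 := Matrix.hasDerivAt_exp_smul_zero h
  have h2 : HasDerivAt (fun t : ℂ => ∑ k ∈ S, Complex.exp (k * t) • P k)
      (∑ k ∈ S, (k : ℂ) • P k) 0 := by
    refine HasDerivAt.fun_sum fun k _ => ?_
    have h3 : HasDerivAt (fun t : ℂ => Complex.exp (k * t)) (k : ℂ) 0 := by
      simpa using ((hasDerivAt_id (0 : ℂ)).const_mul (k : ℂ)).cexp
    exact h3.smul_const (P k)
  refine h1.unique (h2.congr_of_eventuallyEq (Eventually.of_forall fun t => ?_))
  change exp (t • h) = _
  rw [← hT.diag, ← diagHom_apply, ← MonoidHom.comp_apply, hP.coe_eq]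
  refine Finset.sum_congr rfl fun k _ => ?_
  rw [Complex.exp_int_mul]
  simp [expUnit]

theorem diag_eq_one_of_trace_eq_zero (hT : IsTripleOf ρ e h f)
    (hρ : IsRegularMap (fun x : SL(2, ℂ) => (x : GL (Fin 2) ℂ)) ρ) (ht : (h * h).trace = 0)
    (z : ℂˣ) : ρ (diagSL z) = 1 := by
  obtain ⟨S, P, hP⟩ := exists_isWeightDecomposition hρ
  exact hP.eq_one_of_trace_eq_zero (hT.h_eq_sum hP) ht z

end IsTripleOf

/-- In two `sl₂`-triples with the same nilpositive element, the traces of the squares of the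
neutral elements agree. -/
theorem trace_sq_eq_of_same_e {e h f h' f' : Matrix (Fin m) (Fin m) ℂ}
    (he : h * e - e * h = (2 : ℂ) • e) (hf : e * f - f * e = h)
    (he' : h' * e - e * h' = (2 : ℂ) • e) (hf' : e * f' - f' * e = h') :
    (h * h).trace = (h' * h').trace := by
  have hcomm : (h' - h) * e = e * (h' - h) := by
    have : h' * e - e * h' = h * e - e * h := by rw [he, he']
    rw [sub_mul, mul_sub, sub_eq_sub_iff_sub_eq_sub]
    exact this
  -- `h' - h` commutes with `e`, so it is orthogonal for the trace form to the image of `ad e`,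
  -- which contains both `h` and `h'`.
  have key : ∀ g : Matrix (Fin m) (Fin m) ℂ, ((e * g - g * e) * (h' - h)).trace = 0 := fun g => by
    rw [sub_mul, Matrix.trace_sub, mul_assoc g, ← hcomm, ← mul_assoc g,
      Matrix.trace_mul_comm (g * (h' - h)), mul_assoc, sub_self]
  have h1 := key f
  have h2 := key f'
  rw [hf, mul_sub, Matrix.trace_sub, sub_eq_zero] at h1
  rw [hf', mul_sub, Matrix.trace_sub, sub_eq_zero] at h2
  rw [← h1, h2, Matrix.trace_mul_comm]

/-- If `e₁ + t e₂` is conjugate to `e₁`, for commuting `sl₂`-triples and `t ≠ 0`, then the trace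
of the square of `h₂` vanishes. -/
theorem trace_sq_eq_zero_of_conj {e₁ h₁ f₁ e₂ h₂ f₂ : Matrix (Fin m) (Fin m) ℂ}
    (he₁ : h₁ * e₁ - e₁ * h₁ = (2 : ℂ) • e₁) (hf₁ : e₁ * f₁ - f₁ * e₁ = h₁)
    (he₂ : h₂ * e₂ - e₂ * h₂ = (2 : ℂ) • e₂) (hf₂ : e₂ * f₂ - f₂ * e₂ = h₂)
    (heh : Commute e₁ h₂) (hef : Commute e₁ f₂) (hhe : Commute h₁ e₂)
    (hfe : Commute f₁ e₂) (hfh : Commute f₁ h₂) {t : ℂ} (ht : t ≠ 0) {g : GL (Fin m) ℂ}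
    (hg : e₁ + t • e₂ = conjGL g e₁) : (h₂ * h₂).trace = 0 := by
  -- Two triples with nilpositive element `e₁ + t e₂`: the conjugate by `g` of the first one, and
  -- `(e₁ + t e₂, h₁ + h₂, f₁ + t⁻¹ f₂)`. The factor `t⁻¹` keeps `[t e₂, t⁻¹ f₂] = h₂`.
  have h1 := trace_sq_eq_of_same_e (e := conjGL g e₁) (h := conjGL g h₁) (f := conjGL g f₁)
    (h' := h₁ + h₂) (f' := f₁ + t⁻¹ • f₂) (by rw [← conjGL_bracket, he₁, map_smul]) (by rw [← conjGL_bracket, hf₁])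
    (by
      rw [← hg]
      have e1 := heh.eq
      have e2 := hhe.eq
      simp only [add_mul, mul_add, mul_smul_comm, smul_mul_assoc, smul_add, ← he₁,
        smul_comm (2 : ℂ) t, ← he₂, e1, e2, smul_sub]
      abel)
    (by
      rw [← hg]
      have e1 := hef.eq
      have e2 := hfe.eq
      have e3 : t⁻¹ • f₂ * (t • e₂) = f₂ * e₂ := by
        rw [smul_mul_smul_comm, inv_mul_cancel₀ ht, one_smul]
      have e4 : t • e₂ * (t⁻¹ • f₂) = e₂ * f₂ := by
        rw [smul_mul_smul_comm, mul_inv_cancel₀ ht, one_smul]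
      rw [← hf₁, ← hf₂, add_mul, mul_add, mul_add, add_mul, mul_add, mul_add, e3, e4,
        mul_smul_comm, e1, smul_mul_assoc t e₂ f₁, ← e2, mul_smul_comm t, smul_mul_assoc t⁻¹]
      abel)
  have h2 : (conjGL g h₁ * conjGL g h₁).trace = (h₁ * h₁).trace := by
    simp only [conjGL_apply, mul_assoc, Units.inv_mul_cancel_left]
    rw [Matrix.trace_mul_comm]
    simp only [mul_assoc, Units.inv_mul, mul_one]
  -- `h₁ = [e₁, f₁]`, and `h₂` commutes with both `e₁` and `f₁`.
  have h3 : (h₁ * h₂).trace = 0 := by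
    rw [← hf₁, sub_mul, Matrix.trace_sub, mul_assoc f₁, heh.eq, ← mul_assoc f₁, hfh.eq,
      mul_assoc e₁, hfh.eq, Matrix.trace_mul_comm e₁, sub_self]
  rw [h2, add_mul, mul_add, mul_add, Matrix.trace_add, Matrix.trace_add, Matrix.trace_add,
    Matrix.trace_mul_comm h₂ h₁, h3] at h1
  simpa using h1.symm

theorem commute_of_exp_commute {X Y : Matrix (Fin m) (Fin m) ℂ}
    (h : ∀ s t : ℂ, exp (s • X) * exp (t • Y) = exp (t • Y) * exp (s • X)) : Commute X Y := by
  have h1 : ∀ s : ℂ, exp (s • X) * Y * exp (-(s • X)) = Y := fun s => by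
    obtain ⟨g, hg⟩ := Matrix.isUnit_exp (s • X)
    rw [← conjGL_of_coe_eq_exp (g := g) hg]
    refine Matrix.eq_of_exp_smul_eq fun t => ?_
    rw [exp_smul_conjGL, hg, h, ← hg, mul_assoc, Units.mul_inv, mul_one]
  have h2 := Matrix.hasDerivAt_exp_conj X Y
  simp only [h1] at h2
  exact sub_eq_zero.1 (h2.unique (hasDerivAt_const _ _))

/-! ### Injectivity of `EF` on vectors of positive weight -/

section Injectivity

variable {W : Type*} [AddCommGroup W] [Module ℂ W] {E Fm Hm : W →ₗ[ℂ] W}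

theorem pow_weight (hHE : ∀ x, Hm (E x) - E (Hm x) = (2 : ℂ) • E x) {k : ℂ} {v : W}
    (hv : Hm v = k • v) (n : ℕ) : Hm ((E ^ n) v) = (k + 2 * n) • (E ^ n) v := by
  induction n with
  | zero => simpa using hv
  | succ n ih =>
    rw [pow_succ', Module.End.mul_apply, ← sub_add_cancel (Hm (E _)) (E (Hm _)), hHE, ih, map_smul,
      ← add_smul]
    congr 1
    push_cast
    ring

/-- The nonzero vectors among the `E ^ n v` are eigenvectors for the distinct values `k + 2n`, and
there are only finitely many eigenvalues. -/
theorem exists_pow_eq_zero_of_weight [FiniteDimensional ℂ W]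
    (hHE : ∀ x, Hm (E x) - E (Hm x) = (2 : ℂ) • E x) {k : ℂ} {v : W} (hv : Hm v = k • v) :
    ∃ n : ℕ, (E ^ n) v = 0 := by
  by_contra! hne
  have hinj : Function.Injective fun n : ℕ => k + 2 * n := fun a b hab => by
    simpa using hab
  refine Set.infinite_range_of_injective hinj
    ((Module.End.finite_hasEigenvalue Hm).subset ?_)
  rintro _ ⟨n, rfl⟩
  exact Module.End.hasEigenvalue_of_hasEigenvector
    ⟨Module.End.mem_eigenspace_iff.2 (pow_weight hHE hv n), hne n⟩

/-- If `EFv = -cv` then `FEv = -(c + k)v`, so `Ev` satisfies the same equation with `(k + 2, c + k)`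
in place of `(k, c)` and is killed by a smaller power of `E`. By induction `Ev = 0`, whence `(c +
k)v = 0`. The case of interest is `c = 0`; general `c ≥ 0` makes the induction work. -/
theorem eq_zero_of_EF_eq_neg_smul (hEF : ∀ x, E (Fm x) - Fm (E x) = Hm x)
    (hHE : ∀ x, Hm (E x) - E (Hm x) = (2 : ℂ) • E x) (n : ℕ) :
    ∀ (k c : ℝ) (v : W), 0 < k → 0 ≤ c → Hm v = (k : ℂ) • v → (E ^ n) v = 0 →
      E (Fm v) = -(c : ℂ) • v → v = 0 := by
  induction n with
  | zero => intro k c v _ _ _ hn _; simpa using hn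
  | succ n ih =>
    intro k c v hk hc hv hn hEFv
    have h1 : Fm (E v) = -((c + k : ℝ) : ℂ) • v := by
      rw [← sub_sub_cancel (E (Fm v)) (Fm (E v)), hEF, hEFv, hv, ← sub_smul]
      congr 1
      push_cast
      ring
    have h2 : E v = 0 := by
      refine ih (k + 2) (c + k) (E v) (by linarith) (by linarith) ?_ ?_ ?_
      · simpa using pow_weight hHE hv 1
      · rwa [pow_succ] at hn
      · rw [h1, map_smul]
    rw [h2, map_zero] at h1
    refine (smul_eq_zero.1 h1.symm).resolve_left ?_
    have : c + k ≠ 0 := by positivity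
    exact neg_ne_zero.2 (Complex.ofReal_ne_zero.2 this)

end Injectivity

/-- Let `V` be a space of matrices of weight `2` for the adjoint action of an `sl₂`-triple that is
stable under `ad e ∘ ad f`.  Then `ad e ∘ ad f` is surjective on `V`. -/
theorem exists_bracket_bracket_eq {e h f : Matrix (Fin m) (Fin m) ℂ}
    (he : h * e - e * h = (2 : ℂ) • e) (hf : e * f - f * e = h)
    (V : Submodule ℂ (Matrix (Fin m) (Fin m) ℂ)) (hV : ∀ v ∈ V, h * v - v * h = (2 : ℂ) • v)
    (hstab : ∀ v ∈ V, e * (f * v - v * f) - (f * v - v * f) * e ∈ V) :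
    ∀ v ∈ V, ∃ v' ∈ V, e * (f * v' - v' * f) - (f * v' - v' * f) * e = v := by
  let ad : Matrix (Fin m) (Fin m) ℂ → Module.End ℂ (Matrix (Fin m) (Fin m) ℂ) := fun X =>
    LinearMap.mulLeft ℂ X - LinearMap.mulRight ℂ X
  have had : ∀ X Y, ad X Y = X * Y - Y * X := fun X Y => rfl
  have hEF : ∀ x, ad e (ad f x) - ad f (ad e x) = ad h x := fun x => by
    simp only [had, ← hf]
    noncomm_ring
  have hHE : ∀ x, ad h (ad e x) - ad e (ad h x) = (2 : ℂ) • ad e x := fun x => by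
    have h1 : (2 : ℂ) • ad e x = ad ((2 : ℂ) • e) x := by
      simp only [had, smul_mul_assoc, mul_smul_comm, smul_sub]
    rw [h1, ← he]
    simp only [had]
    noncomm_ring
  -- An endomorphism of a finite-dimensional space, so injectivity is enough; it is the case `k =
  -- 2`, `c = 0` of the preceding lemma.
  let T : V →ₗ[ℂ] V := (ad e ∘ₗ ad f).restrict hstab
  have hT : Function.Injective T := (injective_iff_map_eq_zero T).2 fun v hv => by
    have hv2 : ad h v = ((2 : ℝ) : ℂ) • (v : Matrix (Fin m) (Fin m) ℂ) := by
      rw [had]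
      simpa using hV v v.2
    obtain ⟨n, hn⟩ := exists_pow_eq_zero_of_weight hHE hv2
    refine Subtype.ext (eq_zero_of_EF_eq_neg_smul hEF hHE n 2 0 v (by norm_num) le_rfl hv2 hn ?_)
    have h1 : ad e (ad f v) = 0 := congrArg Subtype.val hv
    rw [h1, Complex.ofReal_zero, neg_zero, zero_smul]
  intro v hv
  obtain ⟨v', hv'⟩ := (LinearMap.injective_iff_surjective.1 hT) ⟨v, hv⟩
  exact ⟨v', v'.2, congrArg Subtype.val hv'⟩

end SL2

/-! ### Existence of Weil group elements of nontrivial norm -/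

section Frobenius

variable (p : ℕ) [Fact p.Prime] (F : Type*) [Field F] [Algebra ℚ_[p] F] [FiniteDimensional ℚ_[p] F]

theorem algebraMap_mem_padicIntegers {x : F} (hx : x ∈ padicIntegers p F) :
    algebraMap F (AlgebraicClosure F) x ∈ padicIntegers p (AlgebraicClosure F) := by
  rwa [mem_padicIntegers, ← spectralNorm.eq_of_tower]

/-- The ring of integers of the algebraic closure is an algebra over the ring of integers. -/
abbrev padicIntegersAlgebra : Algebra (padicIntegers p F) (padicIntegers p (AlgebraicClosure F)) :=
  RingHom.toAlgebra <| ((algebraMap F (AlgebraicClosure F)).comp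
    (padicIntegers p F).subtype).codRestrict (padicIntegers p (AlgebraicClosure F)).toSubring
      fun x => algebraMap_mem_padicIntegers p F x.2

theorem smul_mem_padicIntegers (σ : AbsGal F) {x : AlgebraicClosure F}
    (hx : x ∈ padicIntegers p (AlgebraicClosure F)) :
    σ x ∈ padicIntegers p (AlgebraicClosure F) := by
  rwa [mem_padicIntegers, spectralNorm_absGal]

/-- The absolute Galois group acts on the ring of integers of the algebraic closure. -/
abbrev absGalActionIntegers : MulSemiringAction (AbsGal F) (padicIntegers p (AlgebraicClosure F)) where
  smul σ x := ⟨σ x, smul_mem_padicIntegers p F σ x.2⟩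
  one_smul _ := rfl
  mul_smul _ _ _ := rfl
  smul_zero σ := Subtype.ext (map_zero σ)
  smul_add σ x y := Subtype.ext (map_add σ (x : AlgebraicClosure F) y)
  smul_one σ := Subtype.ext (map_one σ)
  smul_mul σ x y := Subtype.ext (map_mul σ (x : AlgebraicClosure F) y)

attribute [local instance] padicIntegersAlgebra absGalActionIntegers

theorem coe_algebraMap_padicIntegers (x : padicIntegers p F) :
    ((algebraMap (padicIntegers p F) (padicIntegers p (AlgebraicClosure F)) x :
      padicIntegers p (AlgebraicClosure F)) : AlgebraicClosure F) =
      algebraMap F (AlgebraicClosure F) x := rfl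

/-- There is an arithmetic Frobenius element in the absolute Galois group. -/
theorem exists_actsAsFrobPow_one_zero : ∃ σ : AbsGal F, ActsAsFrobPow p F σ 1 0 := by
  have : CharZero F := charZero_of_injective_algebraMap (algebraMap ℚ_[p] F).injective
  let A := padicIntegers p F
  let B := padicIntegers p (AlgebraicClosure F)
  have hsc : SMulCommClass (AbsGal F) A B := ⟨fun σ a b => Subtype.ext <| by
    rw [Algebra.smul_def, Algebra.smul_def]
    change σ (algebraMap F _ (a : F) * (b : AlgebraicClosure F)) =
      algebraMap F _ (a : F) * σ (b : AlgebraicClosure F)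
    rw [map_mul, AlgEquiv.commutes]⟩
  -- Galois invariants of the closure are in `F` by characteristic zero, and integrality descends
  -- because the spectral norm does not depend on the field.
  have hinv : Algebra.IsInvariant A B (AbsGal F) := ⟨fun b hb => by
    obtain ⟨x, hx⟩ := (InfiniteGalois.mem_bot_iff_fixed (k := F) (b : AlgebraicClosure F)).2
      fun σ => congrArg Subtype.val (hb σ)
    have hxA : x ∈ A := by
      rw [mem_padicIntegers, spectralNorm.eq_of_tower (L := AlgebraicClosure F)]
      have h1 := b.2
      rw [mem_padicIntegers] at h1
      rw [← hx] at h1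
      exact h1
    exact ⟨⟨x, hxA⟩, Subtype.ext hx⟩⟩
  -- With the discrete topology, continuity of the action says that stabilizers are open; this puts
  -- the profinite group in the setting of invariant ring extensions.
  let _ : TopologicalSpace B := ⊥
  have hdisc : DiscreteTopology B := ⟨rfl⟩
  have hcs : ContinuousSMul (AbsGal F) B := continuousSMul_iff_stabilizer_isOpen.2 fun b => by
    have h1 := stabilizer_isOpen_of_isIntegral (K := F) (b : AlgebraicClosure F)
    convert! h1 using 1
    ext σ
    exact Subtype.ext_iff
  let P := IsLocalRing.maximalIdeal A
  let Q := IsLocalRing.maximalIdeal B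
  have hlo : Q.LiesOver P := ⟨by
    ext x
    rw [Ideal.under_def, Ideal.mem_comap, mem_maximalIdeal_padicIntegers,
      mem_maximalIdeal_padicIntegers, coe_algebraMap_padicIntegers, ← spectralNorm.eq_of_tower]⟩
  let _ : Field (A ⧸ P) := Ideal.Quotient.field P
  let _ : Field (B ⧸ Q) := Ideal.Quotient.field Q
  have hfin : Finite (A ⧸ P) := Nat.finite_of_card_ne_zero (residueCard_ne_zero p F)
  let _ : Fintype (A ⧸ P) := Fintype.ofFinite _
  have hint : Algebra.IsIntegral A B :=
    Algebra.IsInvariant.isIntegral_of_profinite (G := AbsGal F)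
  have hint' : Algebra.IsIntegral (A ⧸ P) (B ⧸ Q) := inferInstance
  -- The decomposition group surjects onto the automorphisms of the residue extension, so the
  -- `q`-power map lifts.
  obtain ⟨σ, hσ⟩ := Ideal.Quotient.stabilizerHom_surjective_of_profinite (G := AbsGal F) P Q
    (FiniteField.frobeniusAlgEquivOfAlgebraic (A ⧸ P) (B ⧸ Q))
  refine ⟨σ.1, fun x hx => ?_⟩
  have h1 := DFunLike.congr_fun hσ (Ideal.Quotient.mk Q ⟨x, hx⟩)
  have hq : Fintype.card (A ⧸ P) = residueCard p F := by
    rw [← Nat.card_eq_fintype_card]; rfl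
  have h2 : Ideal.Quotient.mk Q (σ.1 • ⟨x, hx⟩) =
      (Ideal.Quotient.mk Q ⟨x, hx⟩) ^ residueCard p F := by
    rw [← hq]; exact h1
  rw [← map_pow, Ideal.Quotient.eq, mem_maximalIdeal_padicIntegers] at h2
  simpa using! h2

theorem one_lt_residueCard : 1 < residueCard p F := by
  have hfin : Finite (IsLocalRing.ResidueField (padicIntegers p F)) :=
    Nat.finite_of_card_ne_zero (residueCard_ne_zero p F)
  exact Finite.one_lt_card

/-- A root of the monic polynomial `X ^ a - X ^ b - 1`, which is integral. It shows that the
congruence `x ^ a ≡ x ^ b` cannot hold for all integers `x`. -/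
theorem exists_padicIntegers_pow_sub_pow_eq_one {a b : ℕ} (hab : b < a) :
    ∃ x ∈ padicIntegers p (AlgebraicClosure F), x ^ a - x ^ b = 1 := by
  have hdeg : ∀ (R : Type _) [CommRing R] [Nontrivial R],
      (Polynomial.X ^ b + 1 : Polynomial R).degree < a := fun R _ _ => by
    refine (Polynomial.degree_add_le _ _).trans_lt (max_lt ?_ ?_)
    · rw [Polynomial.degree_X_pow]; exact_mod_cast hab
    · rw [Polynomial.degree_one]; exact_mod_cast (Nat.zero_le b).trans_lt hab
  obtain ⟨x, hx⟩ := IsAlgClosed.exists_root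
    (Polynomial.X ^ a - (Polynomial.X ^ b + 1) : Polynomial (AlgebraicClosure F)) (by
      rw [Polynomial.degree_sub_eq_left_of_degree_lt (by rw [Polynomial.degree_X_pow]; exact hdeg _),
        Polynomial.degree_X_pow]
      exact_mod_cast ((Nat.zero_le b).trans_lt hab).ne')
  rw [Polynomial.IsRoot.def] at hx
  simp only [Polynomial.eval_sub, Polynomial.eval_add, Polynomial.eval_pow, Polynomial.eval_X,
    Polynomial.eval_one] at hx
  have hxint : IsIntegral (padicIntegers p (AlgebraicClosure F)) x :=
    ⟨Polynomial.X ^ a - (Polynomial.X ^ b + 1), Polynomial.monic_X_pow_sub (hdeg _), by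
      simpa only [Polynomial.eval₂_sub, Polynomial.eval₂_add, Polynomial.eval₂_pow,
        Polynomial.eval₂_X, Polynomial.eval₂_one] using hx⟩
  obtain ⟨y, rfl⟩ := IsIntegrallyClosed.isIntegral_iff.1 hxint
  refine ⟨_, y.2, ?_⟩
  change algebraMap _ (AlgebraicClosure F) y ^ a - algebraMap _ (AlgebraicClosure F) y ^ b = 1
  linear_combination hx

/-- There is an element of the Weil group of norm different from `1`. -/
theorem exists_weilNorm_ne_one : ∃ w : WeilGroup p F, weilNorm w ≠ 1 := by
  obtain ⟨σ, hσ⟩ := exists_actsAsFrobPow_one_zero p F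
  let w : WeilGroup p F := ⟨σ, 1, 0, hσ⟩
  refine ⟨w, ?_⟩
  have hq := one_lt_residueCard p F
  -- `weilDeg` is computed from chosen exponents, not from the pair `(1, 0)`. If these were equal to
  -- some `a`, then `x ^ (q ^ (a + 1)) ≡ σ(x) ^ (q ^ a) ≡ x ^ (q ^ a)` for all integers `x`,
  -- contradicting the previous lemma.
  have hdeg : weilDeg w ≠ 0 := by
    obtain ⟨a, b, hab, hw⟩ := weilDeg_spec w
    rw [hw, sub_ne_zero]
    intro h
    obtain rfl : a = b := by exact_mod_cast h
    obtain ⟨x, hx, hx1⟩ := exists_padicIntegers_pow_sub_pow_eq_one p F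
      (Nat.pow_lt_pow_right hq (Nat.lt_succ_self a))
    have h1 := hσ x hx
    have h2 := padic_congr_pow p _ (pow_mem (smul_mem_padicIntegers p F σ hx) _) (pow_mem hx _) h1
      (residueCard p F ^ a)
    have h3 := hab x hx
    have h3' : spectralNorm ℚ_[p] (AlgebraicClosure F)
      (σ x ^ (residueCard p F ^ a) - x ^ (residueCard p F ^ a)) < 1 := h3
    rw [pow_zero, pow_one, pow_one, ← pow_mul, ← neg_sub,
      spectralNorm_neg (Algebra.IsAlgebraic.isAlgebraic _)] at h2
    have h4 := padic_congr_trans p _ h2 h3'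
    rw [← pow_succ', hx1, spectralNorm_one] at h4
    exact lt_irrefl _ h4
  rw [weilNorm, Ne, zpow_eq_one_iff_right₀ (by positivity) (by exact_mod_cast hq.ne')]
  exact hdeg

end Frobenius

/-! ### Open parameters of Arthur type are tempered; tempered ones are of Arthur type -/

section Parameters

open NormedSpace Filter Topology

variable {p : ℕ} [Fact p.Prime] {F : Type*} [Field F] [Algebra ℚ_[p] F]
  [FiniteDimensional ℚ_[p] F] {m : ℕ} {Gd : Subgroup (GL (Fin m) ℂ)}
  {act : AbsGal F →* MulAut Gd}

/-- A homomorphism to the L-group that is trivial on the Weil group, as a homomorphism to the dual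
group. -/
def leftHom {K : Type*} [Group K] (θ : K →* LGroup p act) (h : ∀ k, (θ k).right = 1) : K →* Gd where
  toFun k := (θ k).left
  map_one' := by rw [map_one]; rfl
  map_mul' a b := by simp [h]

theorem inl_leftHom {K : Type*} [Group K] (θ : K →* LGroup p act) (h : ∀ k, (θ k).right = 1)
    (k : K) : SemidirectProduct.inl (leftHom θ h k) = θ k := by
  ext1
  · rfl
  · rw [h]; rfl

/-- The square root of the norm of an element of the Weil group. -/
def sqrtNorm (w : WeilGroup p F) : ℂˣ :=
  Units.mk0 ((√(weilNorm w) : ℝ) : ℂ)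
    (Complex.ofReal_ne_zero.2 (Real.sqrt_ne_zero'.2 (weilNorm_pos w)))

theorem dWeil_eq (w : WeilGroup p F) : dWeil w = diagSL (sqrtNorm w) := rfl

theorem sqrtNorm_sq (w : WeilGroup p F) : ((sqrtNorm w : ℂˣ) : ℂ) ^ 2 = (weilNorm w : ℂ) := by
  rw [sqrtNorm, Units.val_mk0, ← Complex.ofReal_pow, Real.sq_sqrt (weilNorm_pos w).le]

theorem mem_lieAlg_of_oneParam {X : Matrix (Fin m) (Fin m) ℂ} {c : ℂ → Gd}
    (hc : ∀ t, (c t : GL (Fin m) ℂ).val = exp (t • X)) : X ∈ lieAlg Gd :=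
  fun t => ⟨c t, (c t).2, hc t⟩

variable (hreg : ∀ σ : AbsGal F, IsRegularMap (fun g : Gd => (g : GL (Fin m) ℂ))
    (fun g => (act σ g : GL (Fin m) ℂ)))

/-- If `x` conjugates `ρ(u)` to `ρ(d u d⁻¹)` with `d = d_w`, then it multiplies the upper
nilpotent element of the triple of `ρ` by `|w|`. -/
theorem AdL_e_eq {ρ : SL(2, ℂ) →* Gd} {e h f : Matrix (Fin m) (Fin m) ℂ}
    (hT : IsTripleOf (Gd.subtype.comp ρ) e h f) {x : LGroup p act} {w : WeilGroup p F}
    (hx : ∀ u, x * SemidirectProduct.inl (ρ u) * x⁻¹ =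
      SemidirectProduct.inl (ρ (dWeil w * u * (dWeil w)⁻¹))) :
    AdL hreg x e = (weilNorm w : ℂ) • e := by
  refine AdL_eq_of_conj hreg (c := fun t => ρ (upperU t))
    (b := fun t => ρ (upperU ((weilNorm w : ℂ) * t))) hT.upper (fun t => ?_) fun t => ?_
  · rw [smul_smul, mul_comm t]
    exact hT.upper _
  · rw [hx, dWeil_eq, diagSL_conj_upperU, sqrtNorm_sq]

theorem commute_exp_of_commute {K K' : Type*} [Group K] [Group K'] {ρ : K →* Gd} {ρ' : K' →* Gd}
    (hcomm : ∀ x y, ρ x * ρ' y = ρ' y * ρ x) {X Y : Matrix (Fin m) (Fin m) ℂ} {a : ℂ → K}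
    {b : ℂ → K'} (ha : ∀ t, (ρ (a t) : GL (Fin m) ℂ).val = exp (t • X))
    (hb : ∀ t, (ρ' (b t) : GL (Fin m) ℂ).val = exp (t • Y)) : Commute X Y :=
  commute_of_exp_commute fun s t => by
    have h1 := congrArg (fun g : Gd => (g : GL (Fin m) ℂ).val) (hcomm (a s) (b t))
    simpa only [Subgroup.coe_mul, Units.val_mul, ha, hb] using h1

variable {φ : WeilGroup p F × SL(2, ℂ) →* LGroup p act}

/-- An open parameter of Arthur type is tempered. -/
theorem IsOpenParameter.isTempered_of_isOfArthurType (hcl : IsZariskiClosed Gd)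
    (hreg : ∀ σ : AbsGal F, IsRegularMap (fun g : Gd => (g : GL (Fin m) ℂ))
      (fun g => (act σ g : GL (Fin m) ℂ)))
    (hopen : IsOpenParameter φ) (hA : IsOfArthurType φ) : IsTempered φ := by
  obtain ⟨ψ, hψ, hφψ⟩ := hA
  let θ₁ : SL(2, ℂ) →* LGroup p act :=
    ψ.comp ((MonoidHom.inr _ _).comp (MonoidHom.inl _ _))
  let θ₂ : SL(2, ℂ) →* LGroup p act :=
    ψ.comp ((MonoidHom.inr _ _).comp (MonoidHom.inr _ _))
  have hθ₁ : ∀ x, (θ₁ x).right = 1 := fun x => hψ.over_weil (1, x, 1)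
  have hθ₂ : ∀ y, (θ₂ y).right = 1 := fun y => hψ.over_weil (1, 1, y)
  let ρ₁ := leftHom θ₁ hθ₁
  let ρ₂ := leftHom θ₂ hθ₂
  have hi₁ : ∀ x, SemidirectProduct.inl (ρ₁ x) = ψ (1, x, 1) := inl_leftHom θ₁ hθ₁
  have hi₂ : ∀ y, SemidirectProduct.inl (ρ₂ y) = ψ (1, 1, y) := inl_leftHom θ₂ hθ₂
  have hcomm : ∀ x y, ρ₁ x * ρ₂ y = ρ₂ y * ρ₁ x := fun x y => by
    apply SemidirectProduct.inl_injective (φ := act.comp (weilToGal p F))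
    rw [map_mul, map_mul, hi₁, hi₂, ← map_mul, ← map_mul]
    simp
  obtain ⟨e₁, h₁, f₁, hT₁⟩ := exists_isTripleOf (ρ := Gd.subtype.comp ρ₁) hψ.algebraic
  obtain ⟨e₂, h₂, f₂, hT₂⟩ := exists_isTripleOf (ρ := Gd.subtype.comp ρ₂) hψ.algebraic'
  -- The element `d_w` enters symmetrically in the two copies of `SL₂`, so both `e₁` and `e₂` are
  -- scaled by `|w|`.
  have hlam : ∀ w, infParam φ w = ψ (w, dWeil w, dWeil w) := fun w => hφψ w _
  have hV₁ : e₁ ∈ eigenspaceL hreg hcl (infParam φ) fun w => (weilNorm w : ℂ) :=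
    ⟨mem_lieAlg_of_oneParam hT₁.upper, fun w => AdL_e_eq hreg hT₁ fun u => by
      rw [hlam, hi₁, hi₁, ← map_mul, ← map_inv, ← map_mul]
      simp⟩
  have hV₂ : e₂ ∈ eigenspaceL hreg hcl (infParam φ) fun w => (weilNorm w : ℂ) :=
    ⟨mem_lieAlg_of_oneParam hT₂.upper, fun w => AdL_e_eq hreg hT₂ fun u => by
      rw [hlam, hi₂, hi₂, ← map_mul, ← map_inv, ← map_mul]
      simp⟩
  -- Evaluating the relation between `φ` and `ψ` at the identity avoids computing `|1|`, which is
  -- defined through chosen exponents.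
  have hd1 : ψ (1, 1, dWeil (1 : WeilGroup p F)) = 1 := by
    rw [← hφψ, ← map_one φ]; rfl
  have hpt : pointOf φ = e₁ := by
    ext i j
    refine Eq.trans ?_ (Matrix.deriv_exp_smul_entry e₁ i j)
    change deriv _ 0 = _
    congr 1
    funext t
    have h1 : φ (1, upperU t) = SemidirectProduct.inl (ρ₁ (upperU t)) := by
      rw [hi₁, hφψ, ← mul_one (ψ (1, upperU t, 1)), ← hd1, ← map_mul]
      simp
    rw [h1, ← hT₁.upper]
    rfl
  obtain ⟨S, hS⟩ := hopen
  rw [hpt, voganVariety_eq hreg hcl] at hS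
  have he₁ : e₁ ∈ voganOrbit (infParam φ) e₁ := ⟨1, fun w => by simp, by simp⟩
  rw [hS] at he₁
  obtain ⟨-, P, hP, hPe⟩ := he₁
  have hcont : Continuous fun t : ℂ =>
      MvPolynomial.eval (fun ij : Fin m × Fin m => (e₁ + t • e₂) ij.1 ij.2) P := by
    refine (MvPolynomial.continuous_eval P).comp (continuous_pi fun ij => ?_)
    exact continuous_const.add (continuous_id.mul continuous_const)
  have hev : ∀ᶠ t : ℂ in 𝓝 0,
      MvPolynomial.eval (fun ij : Fin m × Fin m => (e₁ + t • e₂) ij.1 ij.2) P ≠ 0 := by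
    refine hcont.continuousAt.eventually_ne ?_
    simpa using hPe
  -- The orbit contains a neighbourhood of `e₁` in `V_λ`, hence `e₁ + t e₂` for some small nonzero
  -- `t`.
  obtain ⟨t, htP, ht⟩ := ((hev.filter_mono (nhdsWithin_le_nhds (s := {0}ᶜ))).and
    self_mem_nhdsWithin).exists
  have hmem : e₁ + t • e₂ ∈ voganOrbit (infParam φ) e₁ := by
    rw [hS]
    exact ⟨Submodule.add_mem _ hV₁ (Submodule.smul_mem _ t hV₂), P, hP, htP⟩
  obtain ⟨g, -, hg⟩ := hmem
  have htr : (h₂ * h₂).trace = 0 :=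
    trace_sq_eq_zero_of_conj hT₁.h_e hT₁.e_f hT₂.h_e hT₂.e_f
      (commute_exp_of_commute hcomm hT₁.upper hT₂.diag)
      (commute_exp_of_commute hcomm hT₁.upper hT₂.lower)
      (commute_exp_of_commute hcomm hT₁.diag hT₂.upper)
      (commute_exp_of_commute hcomm hT₁.lower hT₂.upper)
      (commute_exp_of_commute hcomm hT₁.lower hT₂.diag) ht hg
  -- A vanishing `tr h₂²` makes `ψ` trivial on the second torus, so inserting `d_w` there does not
  -- change `ψ(w, 1, 1)`.
  have hdiag : ∀ z, ψ (1, 1, diagSL z) = 1 := fun z => by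
    rw [← hi₂, show ρ₂ (diagSL z) = 1 from
      Subtype.ext (hT₂.diag_eq_one_of_trace_eq_zero hψ.algebraic' htr z), map_one]
  have hW : ∀ w, φ (w, 1) = ψ (w, 1, 1) := fun w => by
    rw [hφψ, ← mul_one (ψ (w, 1, 1)), ← hdiag (sqrtNorm w), ← map_mul, dWeil_eq]
    simp
  rw [IsTempered]
  simp only [hW]
  exact hψ.bounded

/-- A tempered parameter is of Arthur type. -/
theorem IsTempered.isOfArthurType (hφ : IsLanglandsParameter φ) (ht : IsTempered φ) :
    IsOfArthurType φ := by
  refine ⟨φ.comp (MonoidHom.prodMap (MonoidHom.id _) (MonoidHom.fst _ _)), ?_, fun w x => rfl⟩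
  refine ⟨?_, fun z => hφ.over_weil _, hφ.algebraic, fun i j => ?_, hφ.semisimple, ht⟩
  · exact hφ.continuous.comp (continuous_fst.prodMk (continuous_fst.comp continuous_snd))
  · refine ⟨MvPolynomial.C ((1 : GL (Fin m) ℂ) i j), fun y => ?_⟩
    rw [MvPolynomial.eval_C]
    change ((φ (1, 1)).left : GL (Fin m) ℂ) i j = _
    rw [show φ (1, 1) = 1 from map_one φ]
    rfl

end Parameters

/-! ### Tempered parameters are open -/

section TemperedOpen

open NormedSpace Filter Topology

variable {p : ℕ} [Fact p.Prime] {F : Type*} [Field F] [Algebra ℚ_[p] F]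
  [FiniteDimensional ℚ_[p] F] {m : ℕ} {Gd : Subgroup (GL (Fin m) ℂ)}
  {act : AbsGal F →* MulAut Gd}

/-- An open subgroup of a compact group has finite index. Passing to such a power, the adjoint
action becomes conjugation by the component in the dual group, to which boundedness applies. -/
theorem exists_pow_act_eq_one {F : Type*} [Field F] [CharZero F] {M : Type*} [Group M]
    {act : AbsGal F →* M} (hker : IsOpen (act.ker : Set (AbsGal F))) (σ : AbsGal F) :
    ∃ N : ℕ, N ≠ 0 ∧ act σ ^ N = 1 := by
  have : Finite (AbsGal F ⧸ act.ker) := Subgroup.quotient_finite_of_isOpen _ hker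
  have hfi : act.ker.FiniteIndex := Subgroup.finiteIndex_of_finite_quotient
  obtain ⟨N, hN, -, h⟩ := Subgroup.exists_pow_mem_of_index_ne_zero hfi.index_ne_zero σ
  exact ⟨N, hN.ne', by rw [← map_pow]; exact h⟩

variable (hreg : ∀ σ : AbsGal F, IsRegularMap (fun g : Gd => (g : GL (Fin m) ℂ))
    (fun g => (act σ g : GL (Fin m) ℂ)))

theorem AdL_eq_conjGL_left {x : LGroup p act} (hx : act (weilToGal p F x.right) = 1)
    {X : Matrix (Fin m) (Fin m) ℂ} (hX : X ∈ lieAlg Gd) :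
    AdL hreg x X = conjGL (x.left : GL (Fin m) ℂ) X := by
  refine Matrix.eq_of_exp_smul_eq fun t => ?_
  rw [← innerL_oneParam hreg x hX, exp_smul_conjGL, ← oneParam_val ⟨X, hX⟩]
  simp [innerL, hx]

theorem AdL_zpow {x : LGroup p act} {X : Matrix (Fin m) (Fin m) ℂ} (hX : X ∈ lieAlg Gd) {c : ℂˣ}
    (hx : AdL hreg x X = (c : ℂ) • X) (j : ℤ) : AdL hreg (x ^ j) X = ((c ^ j : ℂˣ) : ℂ) • X := by
  have hinv : ∀ (y : LGroup p act) (d : ℂˣ), AdL hreg y X = (d : ℂ) • X →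
      AdL hreg y⁻¹ X = ((d⁻¹ : ℂˣ) : ℂ) • X := fun y d hy => by
    have h1 := AdL_mul hreg y⁻¹ y hX
    rw [inv_mul_cancel, AdL_one hreg hX, hy, map_smul] at h1
    conv_rhs => rw [h1]
    rw [smul_smul, Units.inv_mul, one_smul]
  have hnat : ∀ n : ℕ, AdL hreg (x ^ n) X = ((c ^ n : ℂˣ) : ℂ) • X := fun n => by
    induction n with
    | zero => rw [pow_zero, pow_zero, AdL_one hreg hX, Units.val_one, one_smul]
    | succ n ih => rw [pow_succ, AdL_mul hreg _ _ hX, hx, map_smul, ih, smul_smul, pow_succ',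
        Units.val_mul]
  obtain ⟨n, rfl | rfl⟩ := j.eq_nat_or_neg
  · simpa only [zpow_natCast] using hnat n
  · rw [_root_.zpow_neg, _root_.zpow_neg, zpow_natCast, zpow_natCast]
    exact hinv _ _ (hnat n)

/-- A relatively compact set of group elements moves a matrix in a bounded set. -/
theorem exists_bound_conjGL {ι : Type*} {u : ι → Gd}
    (hu : IsCompact (closure (Set.range u))) (X : Matrix (Fin m) (Fin m) ℂ) :
    ∃ C : ℝ, ∀ i a b, ‖conjGL (u i : GL (Fin m) ℂ) X a b‖ ≤ C := by
  have hcont : ∀ a b, Continuous fun g : Gd => conjGL (g : GL (Fin m) ℂ) X a b := fun a b => by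
    have h1 : Continuous fun g : Gd => (g : GL (Fin m) ℂ).val :=
      Units.continuous_val.comp continuous_subtype_val
    have h2 : Continuous fun g : Gd => ((g : GL (Fin m) ℂ)⁻¹ : GL (Fin m) ℂ).val :=
      Units.continuous_coe_inv.comp continuous_subtype_val
    exact ((h1.matrix_mul continuous_const).matrix_mul h2).matrix_elem a b
  choose C hC using fun a b => hu.exists_bound_of_continuousOn (hcont a b).continuousOn
  refine ⟨∑ a, ∑ b, |C a b|, fun i a b => ?_⟩
  refine (hC a b _ (subset_closure ⟨i, rfl⟩)).trans ((le_abs_self _).trans ?_)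
  refine (Finset.single_le_sum (f := fun b => |C a b|) (fun _ _ => abs_nonneg _)
    (Finset.mem_univ b)).trans ?_
  exact Finset.single_le_sum (f := fun a => ∑ b, |C a b|)
    (fun _ _ => Finset.sum_nonneg fun _ _ => abs_nonneg _) (Finset.mem_univ a)

/-- The elements of the Lie algebra of the dual group that are invariant under the image of the
Weil group and have weight `k` for the torus of `SL₂`. -/
structure IsInvariantOfWeight (φ : WeilGroup p F × SL(2, ℂ) →* LGroup p act) (ρ : SL(2, ℂ) →* Gd)
    (k : ℤ) (X : Matrix (Fin m) (Fin m) ℂ) : Prop where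
  mem : X ∈ lieAlg Gd
  weight : ∀ z : ℂˣ, conjGL (ρ (diagSL z) : GL (Fin m) ℂ) X = ((z ^ k : ℂˣ) : ℂ) • X
  invariant : ∀ w, AdL hreg (φ (w, 1)) X = X

variable {φ : WeilGroup p F × SL(2, ℂ) →* LGroup p act} {ρ : SL(2, ℂ) →* Gd} {hreg}

theorem IsInvariantOfWeight.bracket (hcl : IsZariskiClosed Gd) {k l : ℤ}
    {X Y : Matrix (Fin m) (Fin m) ℂ}
    (hX : IsInvariantOfWeight hreg φ ρ k X) (hY : IsInvariantOfWeight hreg φ ρ l Y) :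
    IsInvariantOfWeight hreg φ ρ (k + l) (X * Y - Y * X) := by
  refine ⟨bracket_mem_lieSubmodule hcl hX.mem hY.mem, fun z => ?_, fun w => ?_⟩
  · rw [conjGL_bracket, hX.weight, hY.weight, smul_mul_smul_comm, smul_mul_smul_comm,
      mul_comm ((z ^ l : ℂˣ) : ℂ), ← smul_sub, ← Units.val_mul, ← _root_.zpow_add]
  · rw [AdL_bracket hreg _ hX.mem hY.mem, hX.invariant, hY.invariant]

section

variable (hρ : ∀ x, SemidirectProduct.inl (ρ x) = φ (1, x))
include hρ

theorem infParam_eq_mul (w : WeilGroup p F) :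
    infParam φ w = φ (w, 1) * SemidirectProduct.inl (ρ (dWeil w)) := by
  rw [infParam, hρ, ← map_mul]
  simp

theorem AdL_infParam {X : Matrix (Fin m) (Fin m) ℂ} (hX : X ∈ lieAlg Gd) (w : WeilGroup p F) :
    AdL hreg (infParam φ w) X =
      AdL hreg (φ (w, 1)) (conjGL (ρ (dWeil w) : GL (Fin m) ℂ) X) := by
  rw [infParam_eq_mul hρ, AdL_mul hreg _ _ hX, AdL_inl hreg _ hX]

theorem IsInvariantOfWeight.AdL_infParam {k : ℤ} {X : Matrix (Fin m) (Fin m) ℂ}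
    (hX : IsInvariantOfWeight hreg φ ρ k X) (w : WeilGroup p F) :
    AdL hreg (infParam φ w) X = ((sqrtNorm w ^ k : ℂˣ) : ℂ) • X := by
  rw [_root_.AdL_infParam hρ hX.mem, dWeil_eq, hX.weight, map_smul, hX.invariant]

/-- `φ(w, 1)` and `φ(1, x)` commute, being images of the two factors of a direct product. -/
theorem isInvariantOfWeight_e {e h f : Matrix (Fin m) (Fin m) ℂ}
    (hT : IsTripleOf (Gd.subtype.comp ρ) e h f) : IsInvariantOfWeight hreg φ ρ 2 e := by
  refine ⟨mem_lieAlg_of_oneParam hT.upper, fun z => hT.conj_e z, fun w => ?_⟩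
  refine AdL_eq_of_conj hreg (c := fun t => ρ (upperU t)) (b := fun t => ρ (upperU t))
    hT.upper hT.upper fun t => ?_
  rw [hρ, ← map_mul, ← map_inv, ← map_mul]
  simp

theorem isInvariantOfWeight_f {e h f : Matrix (Fin m) (Fin m) ℂ}
    (hT : IsTripleOf (Gd.subtype.comp ρ) e h f) : IsInvariantOfWeight hreg φ ρ (-2) f := by
  refine ⟨mem_lieAlg_of_oneParam hT.lower, fun z => ?_, fun w => ?_⟩
  · refine (hT.conj_f z).trans ?_
    rw [_root_.zpow_neg, ← _root_.inv_zpow]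
    rfl
  · refine AdL_eq_of_conj hreg (c := fun t => ρ (lowerU t)) (b := fun t => ρ (lowerU t))
      hT.lower hT.lower fun t => ?_
    rw [hρ, ← map_mul, ← map_inv, ← map_mul]
    simp

/-- For a tempered parameter, the Vogan variety consists of invariants of weight `2`. -/
theorem isInvariantOfWeight_two (hcl : IsZariskiClosed Gd)
    (hker : IsOpen (act.ker : Set (AbsGal F))) (hright : ∀ z, (φ z).right = z.1)
    (hρreg : IsRegularMap (fun x : SL(2, ℂ) => (x : GL (Fin 2) ℂ)) (Gd.subtype.comp ρ))
    (ht : IsTempered φ) {X : Matrix (Fin m) (Fin m) ℂ}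
    (hX : X ∈ eigenspaceL hreg hcl (infParam φ) fun w => (weilNorm w : ℂ)) :
    IsInvariantOfWeight hreg φ ρ 2 X := by
  obtain ⟨S, P, hP⟩ := IsTripleOf.exists_isWeightDecomposition hρreg
  obtain ⟨w, hw⟩ := exists_weilNorm_ne_one p F
  have : CharZero F := charZero_of_injective_algebraMap (algebraMap ℚ_[p] F).injective
  obtain ⟨N, hN, hactN⟩ := exists_pow_act_eq_one hker (weilToGal p F w)
  set r := sqrtNorm w with hr
  have hr2 : (((r ^ 2 : ℂˣ)) : ℂ) = (weilNorm w : ℂ) := by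
    rw [Units.val_pow_eq_pow_val, hr, sqrtNorm_sq]
  have hweight : ∀ z : ℂˣ, conjGL (ρ (diagSL z) : GL (Fin m) ℂ) X = ((z ^ (2 : ℤ) : ℂˣ) : ℂ) • X := by
    obtain ⟨C, hC⟩ := exists_bound_conjGL ht X
    -- One `w` with `|w| ≠ 1` determines the weight. The parameter is `r ^ N` so that only powers of
    -- `w` acting trivially on the dual group occur.
    refine hP.conj_eq_of_bounded (r := r ^ N) ?_ 2 ⟨C, fun j a b => ?_⟩
    · rw [Units.val_pow_eq_pow_val, norm_pow, Ne, pow_eq_one_iff_of_nonneg (norm_nonneg _) hN]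
      intro h1
      have h2 := congrArg norm hr2
      rw [Units.val_pow_eq_pow_val, norm_pow, h1, one_pow, Complex.norm_real, Real.norm_eq_abs,
        abs_of_pos (weilNorm_pos w)] at h2
      exact hw h2.symm
    · set k : ℤ := N * j with hk
      have hzw : (r ^ N) ^ j = r ^ k := by rw [hk, _root_.zpow_mul, zpow_natCast]
      have hlam : AdL hreg (infParam φ w ^ k) X = (((r ^ 2) ^ k : ℂˣ) : ℂ) • X :=
        AdL_zpow hreg hX.1 (by rw [hX.2, hr2]) k
      -- The torus element is `λ(w)^k` up to `φ(w^{-k}, 1)`. The former scales `X` by `r^{2k}`; the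
      -- latter acts by conjugation within a bounded set. So `X` has weight `2` up to a bounded
      -- error, hence exactly.
      have hfac : SemidirectProduct.inl (ρ (diagHom (r ^ k))) =
          φ (w ^ (-k), 1) * infParam φ w ^ k := by
        rw [infParam, hρ, ← map_zpow, ← map_mul, map_zpow, diagHom_apply, ← dWeil_eq]
        simp
      have hconj : conjGL (ρ (diagHom (r ^ k)) : GL (Fin m) ℂ) X =
          (((r ^ 2) ^ k : ℂˣ) : ℂ) • conjGL ((φ (w ^ (-k), 1)).left : GL (Fin m) ℂ) X := by
        rw [← AdL_inl (p := p) hreg _ hX.1, hfac, AdL_mul hreg _ _ hX.1, hlam, map_smul,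
          AdL_eq_conjGL_left hreg _ hX.1]
        rw [hright, map_zpow, map_zpow, hk, ← mul_neg, _root_.zpow_mul, zpow_natCast, hactN,
          _root_.one_zpow]
      rw [hzw, MonoidHom.comp_apply, MonoidHom.comp_apply, Subgroup.subtype_apply, hconj, smul_smul,
        ← Units.val_mul]
      have hone : (r ^ k) ^ (-2 : ℤ) * (r ^ 2) ^ k = 1 := by
        rw [← zpow_natCast r 2, ← _root_.zpow_mul, ← _root_.zpow_mul, ← _root_.zpow_add]
        simp [mul_comm]
      rw [hone, Units.val_one, one_smul]
      exact hC _ a b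
  refine ⟨hX.1, hweight, fun w' => ?_⟩
  -- Once `φ(1, d_w')` is known to scale `X` by `|w'|`, cancelling this factor leaves the invariance
  -- under `φ(w', 1)`.
  have h1 := hX.2 w'
  rw [AdL_infParam hρ hX.1, dWeil_eq, hweight, map_smul] at h1
  have h2 : ((sqrtNorm w' ^ (2 : ℤ) : ℂˣ) : ℂ) = (weilNorm w' : ℂ) := sqrtNorm_sq w'
  rw [h2] at h1
  exact smul_right_injective _ (Complex.ofReal_ne_zero.2 (weilNorm_pos w').ne') h1

end

/-- The centralizer of a map to the L-group, as a group of matrices. -/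
def centralizerSubgroup (lam : WeilGroup p F → LGroup p act) : Subgroup (GL (Fin m) ℂ) :=
  Subgroup.map Gd.subtype
    { carrier := centralizerOf lam
      one_mem' := fun w => by simp
      mul_mem' := fun {a b} ha hb w => by
        rw [map_mul, _root_.mul_inv_rev]
        calc _ = SemidirectProduct.inl a *
              (SemidirectProduct.inl b * lam w * (SemidirectProduct.inl b)⁻¹) *
              (SemidirectProduct.inl a)⁻¹ := by group
          _ = _ := by rw [hb w, ha w]
      inv_mem' := fun {a} ha w => by
        conv_lhs => rw [← ha w]
        rw [map_inv]
        group }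

theorem mem_centralizerSubgroup {lam : WeilGroup p F → LGroup p act} {g : GL (Fin m) ℂ} :
    g ∈ centralizerSubgroup lam ↔ ∃ x : Gd, x ∈ centralizerOf lam ∧ (x : GL (Fin m) ℂ) = g :=
  Iff.rfl

/-- A tempered parameter is open. -/
theorem IsTempered.isOpenParameter (hcl : IsZariskiClosed Gd)
    (hreg : ∀ σ : AbsGal F, IsRegularMap (fun g : Gd => (g : GL (Fin m) ℂ))
      (fun g => (act σ g : GL (Fin m) ℂ)))
    (hker : IsOpen (act.ker : Set (AbsGal F))) (hφ : IsLanglandsParameter φ)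
    (ht : IsTempered φ) : IsOpenParameter φ := by
  let θ : SL(2, ℂ) →* LGroup p act := φ.comp (MonoidHom.inr _ _)
  have hθ : ∀ x, (θ x).right = 1 := fun x => hφ.over_weil (1, x)
  let ρ := leftHom θ hθ
  have hρ : ∀ x, SemidirectProduct.inl (ρ x) = φ (1, x) := inl_leftHom θ hθ
  have hρreg : IsRegularMap (fun x : SL(2, ℂ) => (x : GL (Fin 2) ℂ)) (Gd.subtype.comp ρ) :=
    hφ.algebraic
  obtain ⟨e, h, f, hT⟩ := exists_isTripleOf hρreg
  have hpt : pointOf φ = e := by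
    ext i j
    refine Eq.trans ?_ (Matrix.deriv_exp_smul_entry e i j)
    change deriv _ 0 = _
    congr 1
    funext t
    rw [← hT.upper]
    rfl
  let V := eigenspaceL hreg hcl (infParam φ) fun w => (weilNorm w : ℂ)
  let H₀ := eigenspaceL hreg hcl (infParam φ) fun _ => 1
  have hVinv : ∀ X ∈ V, IsInvariantOfWeight hreg φ ρ 2 X := fun X hX =>
    isInvariantOfWeight_two hρ hcl hker hφ.over_weil hρreg ht hX
  have hVmem : ∀ X, IsInvariantOfWeight hreg φ ρ 2 X → X ∈ V := fun X hX =>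
    ⟨hX.mem, fun w => by
      rw [hX.AdL_infParam hρ, show ((sqrtNorm w ^ (2 : ℤ) : ℂˣ) : ℂ) = (weilNorm w : ℂ) from
        sqrtNorm_sq w]⟩
  have he : IsInvariantOfWeight hreg φ ρ 2 e := isInvariantOfWeight_e hρ hT
  have hf : IsInvariantOfWeight hreg φ ρ (-2) f := isInvariantOfWeight_f hρ hT
  have hsurj : ∀ Z ∈ V, ∃ X ∈ H₀, X * e - e * X = Z := fun Z hZ => by
    obtain ⟨v, hv, hvZ⟩ := exists_bracket_bracket_eq hT.h_e hT.e_f V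
      (fun v hv => by
        have := hT.bracket_h_of_conj (hVinv v hv).weight
        simpa using this)
      (fun v hv => hVmem _ (he.bracket hcl (hf.bracket hcl (hVinv v hv)))) Z hZ
    have hX := hf.bracket hcl (hVinv v hv)
    -- `[f, v]` is invariant of weight `-2 + 2 = 0`, hence fixed by `λ`; the sign comes from `[-[f,
    -- v], e] = [e, [f, v]]`.
    refine ⟨-(f * v - v * f), H₀.neg_mem ⟨hX.mem, fun w => ?_⟩, ?_⟩
    · rw [hX.AdL_infParam hρ]
      simp
    · rw [← hvZ]
      noncomm_ring
  have hmain := isZariskiOpenIn_orbit (V := V) (h := H₀) (H := centralizerSubgroup (infParam φ))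
    (fun g hg X hX => by
      obtain ⟨x, hx, rfl⟩ := mem_centralizerSubgroup.1 hg
      exact conjGL_mem_eigenspaceL hreg hcl hx hX)
    (fun g hg X hX => by
      obtain ⟨x, hx, rfl⟩ := mem_centralizerSubgroup.1 hg
      exact conjGL_mem_eigenspaceL hreg hcl hx hX)
    (fun X hX => by
      obtain ⟨g, hg, hgX⟩ := exists_mem_coe_eq_exp hX.1
      exact ⟨g, mem_centralizerSubgroup.2
        ⟨⟨g, hg⟩, mem_centralizerOf_of_exp hreg hcl hX hgX, rfl⟩, hgX⟩)
    (hVmem e he) hsurj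
  rw [IsOpenParameter, voganVariety_eq hreg hcl, hpt]
  convert! hmain using 1
  ext Y
  constructor
  · rintro ⟨g, hg, hY⟩
    exact ⟨g, mem_centralizerSubgroup.2 ⟨g, hg, rfl⟩, hY⟩
  · rintro ⟨g, hg, hY⟩
    obtain ⟨x, hx, rfl⟩ := mem_centralizerSubgroup.1 hg
    exact ⟨x, hx, hY⟩

end TemperedOpen

end

/-- A Langlands parameter of a connected reductive group `G` over a `p`-adic field `F` is tempered
if and only if it is open and of Arthur type. -/
theorem proposition3p3 (p : ℕ) [Fact p.Prime] (F : Type*) [Field F] [Algebra ℚ_[p] F]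
    [FiniteDimensional ℚ_[p] F]
    (n : ℕ) (G : Subgroup (GL (Fin n) (AlgebraicClosure F)))
    (hGF : IsDefinedOver F G) (hG : IsConnectedReductive G)
    (m : ℕ) (Gd : Subgroup (GL (Fin m) ℂ)) (act : AbsGal F →* MulAut Gd)
    (hGd : IsDualGroup G Gd act)
    (φ : WeilGroup p F × SL(2, ℂ) →* LGroup p act) (hφ : IsLanglandsParameter φ) :
    IsTempered φ ↔ IsOpenParameter φ ∧ IsOfArthurType φ :=
  ⟨fun ht => ⟨ht.isOpenParameter hGd.reductive.closed hGd.regular hGd.finite_quotient hφ,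
    ht.isOfArthurType hφ⟩,
    fun h => h.1.isTempered_of_isOfArthurType hGd.reductive.closed hGd.regular h.2⟩
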